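/- **Setting.** For every number of observations $T\in\mathbb N$ let $X=X_T\in\mathbb R^{T\times J}$ ($J=J_T$) be a deterministic design matrix with columns $X_i$, $\beta=\beta_T\in\mathbb R^{J}$, and $Y=X\beta+\epsilon$, where $\epsilon\in\mathbb R^T$ has i.i.d. $N(0,\sigma^2)$ entries, $\sigma^2>0$ not depending on $T$. Let $\lambda=\lambda_T>0$, and let $\omega_i\in(0,\infty]$ be weights with $\sum_{i\le J}\omega_i^{-1}=J$ (where $1/\infty=0$). The weighted LASSO estimator $\hat\beta=\hat\beta(Y)$ is the minimizer of $$b\mapsto \frac1{2T}\|Y-Xb\|_2^2+\lambda\sum_{i\le J}\frac{|b_i|}{\omega_i}.$$ Let $m\ge1$ be fixed, let $M=M_T=(i_1,\dots,i_m)$ be a list of $m$ distinct covariates, and let $S$ be a fixed set of sign vectors of length $m$. The selection event $E=E_T$ is the event that the minimizer $\hat\beta$ is unique, its set of nonzero coordinates is $M$, and $\hat s=\mathrm{sign}(\hat\beta_M)\in S$. (For $S=\{s\}$ this is conditioning on the selected pair $(M,s)$; if $S$ consists of all sign vectors, it is conditioning on the selected set $M$ alone.) Put $X_M^+=(X_M^\top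 X_M)^{-1}X_M^\top$, $P_M=X_MX_M^+$, and fix $j\in\{1,\dots,m\}$. The debiased estimator is $\bar\beta_M=\hat\beta_M+X_M^+(Y-X_M\hat\beta_M)$. Let $\eta=(X_M^+)^\top e_j$, $\xi=\eta/\|\eta\|_2^2$, $z=(I-\xi\eta^\top)Y$, $s=\hat s$, $\Lambda=T\lambda$, and $$A=\begin{bmatrix}\Lambda^{-1}X_{-M}^\top(I-P_M)\\-\Lambda^{-1}X_{-M}^\top(I-P_M)\\-\mathrm{diag}(s)X_M^+\end{bmatrix},\qquad b=\begin{bmatrix}\omega_{-M}^{-1}-X_{-M}^\top(X_M^+)^\top(s\odot\omega_M^{-1})\\\omega_{-M}^{-1}+X_{-M}^\top(X_M^+)^\top(s\odot\omega_M^{-1})\\-\Lambda\,\mathrm{diag}(s)(X_M^\top X_M)^{-1}(s\odot\omega_M^{-1})\end{bmatrix},$$ $$V^-(z)=\max_{k:(A\xi)_k<0}\frac{b_k-(Az)_k}{(A\xi)_k},\qquad V^+(z)=\min_{k:(A\xi)_k>0}\frac{b_k-(Az)_k}{(A\xi)_k}\qquad(\max\emptyset=-\infty,\ \min\emptyset=+\infty).$$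 Let $\hat\sigma^2=\hat\sigma_T^2(Y)$ be a measurable estimator of the residual variance, $\hat\sigma=\sqrt{\hat\sigma^2}$, $$Q=\frac{\bar\beta_j}{\|\eta\|_2\hat\sigma},\qquad \Omega=\left[\frac{V^-(z)}{\|\eta\|_2\hat\sigma},\frac{V^+(z)}{\|\eta\|_2\hat\sigma}\right],$$ and let $TN_\Omega$ be the standard normal distribution truncated to $\Omega$, with distribution function $F_\Omega$. **Assumptions.** For all sufficiently large $T$: the columns of $X$ are in general position (no $\pm X_i$ lies in the affine span of finitely many points $\pm X_k$ with distinct indices $k\ne i$, one sign for each $k$), $J<T$, and $\mathbb P(E)>0$. As $T\to\infty$: $|\{i:\beta_i\ne0\}|=O(1)$; conditionally on $E$, $\hat\sigma^2\to\sigma^2$ in probability; $\frac1TX_M^\top X_M$ converges to a matrix of full rank; $J=O(T)$ and $\lambda=O(\sqrt{\log J/T})$. The null hypothesis holds for all large $T$: the $j$-th coefficient of the selected model vanishes, $e_j^\top X_M^+\,\mathbb E[Y]=0$. (If $M$ contains all $i$ with $\beta_i\neq0$, this says that the true coefficient of the $j$-th selected covariate is zero.) **Conclusion.** As $T\to\infty$: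 1. Conditionally on the selection (and on $z$), the studentized statistic converges to the truncated normal distribution $TN_\Omega$: $$\sup_f\ \mathbb E\Big[\Big|\mathbb E\Big[f(Q)-\int f\,dTN_\Omega\,\Big|\,E,z\Big]\Big|\;\Big|\;E\Big]\longrightarrow0,$$ where $f$ runs over the $1$-Lipschitz functions $\mathbb R\to[-1,1]$. 2. The lower-tail, upper-tail and two-sided p-values, $p=F_\Omega(Q)$, $p=1-F_\Omega(Q)$ and $p=2\min\{F_\Omega(Q),1-F_\Omega(Q)\}$, are asymptotically valid given the selection: $\limsup_{T\to\infty}\mathbb P(p\le x\mid E)\le x$ for all $x\ge0$, and indeed $\mathbb P(p\le x\mid E)\to x$ for all $x\in[0,1]$. -/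

import Mathlib

open MeasureTheory ProbabilityTheory Filter Topology Asymptotics
open scoped NNReal ENNReal Matrix

namespace WeightedLasso

noncomputable section

/-- The data of one regression with `T` observations: the number `J` of candidate covariates, the
design matrix, the true coefficient vector, the prior weights in `[0, ∞]` (they are required to be
nonzero where this is used), and the penalty level `lam`. -/
structure Regression (T : ℕ) where
  J : ℕ
  X : Matrix (Fin T) (Fin J) ℝ
  coef : Fin J → ℝ
  weight : Fin J → ℝ≥0∞
  lam : ℝ

variable {T m : ℕ}

/-- The inverse weight `1 / ω_i`, equal to `0` if `ω_i = ∞`. -/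
def invWeight (R : Regression T) (i : Fin R.J) : ℝ := ((R.weight i)⁻¹).toReal

/-- Admissible weights: `ω_i ∈ (0, ∞]` and `∑ ω_i⁻¹ = J`. -/
def AdmissibleWeights (R : Regression T) : Prop :=
  (∀ i, R.weight i ≠ 0) ∧ ∑ i, invWeight R i = (R.J : ℝ)

/-- The weighted LASSO objective `(1 / 2T) ‖y - X b‖² + λ ∑ |b_i| / ω_i`. -/
def objective (R : Regression T) (y : Fin T → ℝ) (b : Fin R.J → ℝ) : ℝ :=
  1 / (2 * (T : ℝ)) * ∑ t, (y t - (R.X *ᵥ b) t) ^ 2 + R.lam * ∑ i, |b i| * invWeight R i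

/-- The set of all minimizers of the weighted LASSO objective. -/
def minimizers (R : Regression T) (y : Fin T → ℝ) : Set (Fin R.J → ℝ) :=
  {b | ∀ b', objective R y b ≤ objective R y b'}

open Classical in
/-- The weighted LASSO estimator: the minimizer, where it is unique. Its value elsewhere plays no
role, since the selection events below contain the uniqueness of the minimizer. -/
def lasso (R : Regression T) (y : Fin T → ℝ) : Fin R.J → ℝ :=
  if h : ∃ b, minimizers R y = {b} then h.choose else 0

/-- The columns of the design are in general position: no `± X_i` lies in the affine span of
signed columns other than the `i`-th. -/
def GeneralPosition (R : Regression T) : Prop :=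
  ∀ (I : Finset (Fin R.J)) (τ : Fin R.J → ℝ), (∀ k, τ k = 1 ∨ τ k = -1) → ∀ i ∉ I,
    R.X.col i ∉ affineSpan ℝ ((fun k => τ k • R.X.col k) '' (I : Set (Fin R.J))) ∧
      -R.X.col i ∉ affineSpan ℝ ((fun k => τ k • R.X.col k) '' (I : Set (Fin R.J)))

/-- The law of `Y = X β + ε` for `ε` with independent `N(0, v)` entries. -/
def responseLaw (R : Regression T) (v : ℝ≥0) : Measure (Fin T → ℝ) :=
  (Measure.pi (fun _ : Fin T => gaussianReal 0 v)).map (fun e => R.X *ᵥ R.coef + e)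

/-! A selected model is an enumeration `M : Fin m ↪ Fin R.J` of the `m` selected covariates. -/

/-- The submatrix `X_M` of the selected covariates. -/
def selDesign (R : Regression T) (M : Fin m ↪ Fin R.J) : Matrix (Fin T) (Fin m) ℝ :=
  R.X.submatrix id M

/-- `X_M⁺ = (X_Mᵀ X_M)⁻¹ X_Mᵀ`. -/
def pinv (R : Regression T) (M : Fin m ↪ Fin R.J) : Matrix (Fin m) (Fin T) ℝ :=
  ((selDesign R M)ᵀ * selDesign R M)⁻¹ * (selDesign R M)ᵀ

/-- The projection `P_M = X_M X_M⁺`. -/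
def proj (R : Regression T) (M : Fin m ↪ Fin R.J) : Matrix (Fin T) (Fin T) ℝ :=
  selDesign R M * pinv R M

/-- The signs of the LASSO estimate on `M`. -/
def lassoSigns (R : Regression T) (M : Fin m ↪ Fin R.J) (y : Fin T → ℝ) : Fin m → SignType :=
  fun k => SignType.sign (lasso R y (M k))

/-- The selection event: the weighted LASSO minimizer is unique, its active set is `M`, and its
signs on `M` form a vector in `S`. For `S = {s}` this is the event that `(M, s)` is selected; for
`S = Set.univ` it is the event that `M` is selected. -/
def selectionEvent (R : Regression T) (M : Fin m ↪ Fin R.J) (S : Set (Fin m → SignType)) :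
    Set (Fin T → ℝ) :=
  {y | minimizers R y = {lasso R y} ∧ (∀ i, lasso R y i ≠ 0 ↔ i ∈ Set.range M) ∧
    lassoSigns R M y ∈ S}

/-- The debiased estimator `β̂_M + X_M⁺ (Y - X_M β̂_M)`. -/
def debiased (R : Regression T) (M : Fin m ↪ Fin R.J) (y : Fin T → ℝ) : Fin m → ℝ :=
  (fun k => lasso R y (M k)) +
    pinv R M *ᵥ (y - selDesign R M *ᵥ (fun k => lasso R y (M k)))

/-- The coefficients of the selected model: the population regression `X_M⁺ E[Y]` of `Y` on the
selected covariates. -/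
def selCoef (R : Regression T) (M : Fin m ↪ Fin R.J) : Fin m → ℝ :=
  pinv R M *ᵥ (R.X *ᵥ R.coef)

/-- If the selected model contains all active covariates, the coefficients of the selected model
are the true coefficients. -/
theorem selCoef_eq_coef (R : Regression T) (M : Fin m ↪ Fin R.J)
    (hM : ∀ i, R.coef i ≠ 0 → i ∈ Set.range M)
    (hdet : IsUnit ((selDesign R M)ᵀ * selDesign R M).det) (j : Fin m) :
    selCoef R M j = R.coef (M j) := by
  have h : R.X *ᵥ R.coef = selDesign R M *ᵥ (fun k => R.coef (M k)) := by
    funext t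
    simp only [Matrix.mulVec, dotProduct, selDesign, Matrix.submatrix_apply, id]
    symm
    refine Fintype.sum_of_injective M M.injective _ _ ?_ (fun _ => rfl)
    intro i hi
    have : R.coef i = 0 := by
      by_contra h0
      exact hi (hM i h0)
    simp [this]
  rw [selCoef, h, pinv, Matrix.mulVec_mulVec, Matrix.mul_assoc, Matrix.nonsing_inv_mul _ hdet,
    Matrix.one_mulVec]

/-- `η = (X_M⁺)ᵀ e_j`. -/
def eta (R : Regression T) (M : Fin m ↪ Fin R.J) (j : Fin m) : Fin T → ℝ :=
  (pinv R M)ᵀ *ᵥ Pi.single j 1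

/-- The Euclidean norm of `η`. -/
def etaNorm (R : Regression T) (M : Fin m ↪ Fin R.J) (j : Fin m) : ℝ :=
  √(eta R M j ⬝ᵥ eta R M j)

/-- `ξ = Σ η (ηᵀ Σ η)⁻¹`, which is `η / ‖η‖²` for `Σ = σ² I`. -/
def xi (R : Regression T) (M : Fin m ↪ Fin R.J) (j : Fin m) : Fin T → ℝ :=
  (eta R M j ⬝ᵥ eta R M j)⁻¹ • eta R M j

/-- `z = (I - ξ ηᵀ) Y`. -/
def resid (R : Regression T) (M : Fin m ↪ Fin R.J) (j : Fin m) (y : Fin T → ℝ) : Fin T → ℝ :=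
  y - (eta R M j ⬝ᵥ y) • xi R M j

/-- The inactive covariates. -/
abbrev Inactive (R : Regression T) (M : Fin m ↪ Fin R.J) : Type :=
  {i : Fin R.J // i ∉ Set.range M}

/-- The submatrix `X_{-M}` of the inactive covariates. -/
def inactDesign (R : Regression T) (M : Fin m ↪ Fin R.J) :
    Matrix (Fin T) (Inactive R M) ℝ :=
  R.X.submatrix id Subtype.val

/-- The coefficient of the penalty in the objective multiplied by `T`, that is in
`(1 / 2) ‖y - X b‖² + (T λ) ∑ |b_i| / ω_i`. -/
def penalty (R : Regression T) : ℝ := (T : ℝ) * R.lam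

/-- The vector `s ⊙ ω_M⁻¹`. -/
def signWeight (R : Regression T) (M : Fin m ↪ Fin R.J) (s : Fin m → SignType) : Fin m → ℝ :=
  fun k => (s k : ℝ) * invWeight R (M k)

/-- Index set of the linear constraints that describe the selection of `(M, s)`. -/
abbrev Constraint (R : Regression T) (M : Fin m ↪ Fin R.J) : Type :=
  Inactive R M ⊕ (Inactive R M ⊕ Fin m)

/-- The matrix `A` of the constraints `A Y ≤ b`, with blocks `Λ⁻¹ X_{-M}ᵀ (I - P_M)`,
`-Λ⁻¹ X_{-M}ᵀ (I - P_M)` and `-diag(s) X_M⁺`, where `Λ = T λ`. -/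
def constraintMatrix (R : Regression T) (M : Fin m ↪ Fin R.J) (s : Fin m → SignType) :
    Matrix (Constraint R M) (Fin T) ℝ :=
  Matrix.fromRows ((penalty R)⁻¹ • ((inactDesign R M)ᵀ * (1 - proj R M)))
    (Matrix.fromRows (-((penalty R)⁻¹ • ((inactDesign R M)ᵀ * (1 - proj R M))))
      (-(Matrix.diagonal (fun k => (s k : ℝ)) * pinv R M)))

/-- The vector `b` of the constraints `A Y ≤ b`, with blocks
`ω_{-M}⁻¹ - X_{-M}ᵀ (X_M⁺)ᵀ (s ⊙ ω_M⁻¹)`, `ω_{-M}⁻¹ + X_{-M}ᵀ (X_M⁺)ᵀ (s ⊙ ω_M⁻¹)` and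
`-Λ diag(s) (X_Mᵀ X_M)⁻¹ (s ⊙ ω_M⁻¹)`, where `Λ = T λ`. -/
def constraintBound (R : Regression T) (M : Fin m ↪ Fin R.J) (s : Fin m → SignType) :
    Constraint R M → ℝ :=
  Sum.elim
    (fun i => invWeight R i.1 -
      ((inactDesign R M)ᵀ *ᵥ ((pinv R M)ᵀ *ᵥ signWeight R M s)) i)
    (Sum.elim
      (fun i => invWeight R i.1 +
        ((inactDesign R M)ᵀ *ᵥ ((pinv R M)ᵀ *ᵥ signWeight R M s)) i)
      (fun k => -(penalty R * ((s k : ℝ) *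
        ((((selDesign R M)ᵀ * selDesign R M)⁻¹ *ᵥ signWeight R M s) k)))))

/-- `V⁻(z) = max {(b_k - (A z)_k) / (A ξ)_k : (A ξ)_k < 0}`, with `max ∅ = -∞`. -/
def Vminus (R : Regression T) (M : Fin m ↪ Fin R.J) (s : Fin m → SignType) (j : Fin m)
    (z : Fin T → ℝ) : EReal :=
  ⨆ (k : Constraint R M) (_ : (constraintMatrix R M s *ᵥ xi R M j) k < 0),
    (((constraintBound R M s k - (constraintMatrix R M s *ᵥ z) k) /
      (constraintMatrix R M s *ᵥ xi R M j) k : ℝ) : EReal)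

/-- `V⁺(z) = min {(b_k - (A z)_k) / (A ξ)_k : (A ξ)_k > 0}`, with `min ∅ = ∞`. -/
def Vplus (R : Regression T) (M : Fin m ↪ Fin R.J) (s : Fin m → SignType) (j : Fin m)
    (z : Fin T → ℝ) : EReal :=
  ⨅ (k : Constraint R M) (_ : 0 < (constraintMatrix R M s *ᵥ xi R M j) k),
    (((constraintBound R M s k - (constraintMatrix R M s *ᵥ z) k) /
      (constraintMatrix R M s *ᵥ xi R M j) k : ℝ) : EReal)

/-! Below, `vhat : (Fin T → ℝ) → ℝ` is an estimator of the residual variance, `σ̂ = √vhat`. -/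

/-- The scale `‖η‖ σ̂(Y)`. -/
def scale (R : Regression T) (M : Fin m ↪ Fin R.J) (j : Fin m) (vhat : (Fin T → ℝ) → ℝ)
    (y : Fin T → ℝ) : ℝ :=
  etaNorm R M j * √(vhat y)

/-- The studentized statistic `β̄_j / (‖η‖ σ̂(Y))`. -/
def studentized (R : Regression T) (M : Fin m ↪ Fin R.J) (j : Fin m) (vhat : (Fin T → ℝ) → ℝ)
    (y : Fin T → ℝ) : ℝ :=
  debiased R M y j / scale R M j vhat y

/-- The truncation set `[V⁻(z) / (‖η‖ σ̂(Y)), V⁺(z) / (‖η‖ σ̂(Y))]`, at the observed signs. -/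
def truncationSet (R : Regression T) (M : Fin m ↪ Fin R.J) (j : Fin m) (vhat : (Fin T → ℝ) → ℝ)
    (y : Fin T → ℝ) : Set ℝ :=
  {t | Vminus R M (lassoSigns R M y) j (resid R M j y) / (scale R M j vhat y : EReal) ≤ (t : EReal) ∧
    (t : EReal) ≤ Vplus R M (lassoSigns R M y) j (resid R M j y) / (scale R M j vhat y : EReal)}

/-- The standard normal distribution truncated to the set `C`. -/
def truncNormal (C : Set ℝ) : Measure ℝ := ProbabilityTheory.cond (gaussianReal 0 1) C

/-- The distribution function of the truncated standard normal distribution, at the studentized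
statistic. It is the lower-tail p-value. -/
def pLower (R : Regression T) (M : Fin m ↪ Fin R.J) (j : Fin m) (vhat : (Fin T → ℝ) → ℝ)
    (y : Fin T → ℝ) : ℝ :=
  (truncNormal (truncationSet R M j vhat y)).real (Set.Iic (studentized R M j vhat y))

/-- The upper-tail p-value. -/
def pUpper (R : Regression T) (M : Fin m ↪ Fin R.J) (j : Fin m) (vhat : (Fin T → ℝ) → ℝ)
    (y : Fin T → ℝ) : ℝ :=
  1 - pLower R M j vhat y

/-- The two-sided p-value. -/
def pTwoSided (R : Regression T) (M : Fin m ↪ Fin R.J) (j : Fin m) (vhat : (Fin T → ℝ) → ℝ)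
    (y : Fin T → ℝ) : ℝ :=
  2 * min (pLower R M j vhat y) (pUpper R M j vhat y)

/-- Conditionally on the event `E T`, `vhat T` converges in probability to `v`. -/
def ConsistentGiven (μ : ∀ T : ℕ, Measure (Fin T → ℝ)) (E : ∀ T : ℕ, Set (Fin T → ℝ))
    (vhat : ∀ T : ℕ, (Fin T → ℝ) → ℝ) (v : ℝ) : Prop :=
  ∀ δ > 0, Tendsto (fun T => (ProbabilityTheory.cond (μ T) (E T)).real {y | δ ≤ |vhat T y - v|})
    atTop (𝓝 0)

/-- The conditional law of the statistic `Q T` given `E T` and `Z T` merges weakly with the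
data-dependent target distribution `ν T y`: in the bounded Lipschitz sense,
`E |E[f(Q) - ∫ f dν | E, Z]| → 0`, uniformly over the test functions `f` that are bounded by `1`
and `1`-Lipschitz. (If `ν` is a function of `Z`, the inner term is `E[f(Q) | E, Z] - ∫ f dν`.) -/
def ConvergesWeaklyGiven (μ : ∀ T : ℕ, Measure (Fin T → ℝ)) (E : ∀ T : ℕ, Set (Fin T → ℝ))
    (Z : ∀ T : ℕ, (Fin T → ℝ) → (Fin T → ℝ)) (Q : ∀ T : ℕ, (Fin T → ℝ) → ℝ)
    (ν : ∀ T : ℕ, (Fin T → ℝ) → Measure ℝ) : Prop :=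
  ∀ δ > 0, ∀ᶠ T in atTop, ∀ f : ℝ → ℝ, (∀ x, |f x| ≤ 1) → LipschitzWith 1 f →
    Integrable (fun y => f (Q T y) - ∫ x, f x ∂(ν T y)) (ProbabilityTheory.cond (μ T) (E T)) ∧
    ∫ y, |((ProbabilityTheory.cond (μ T) (E T))[fun y => f (Q T y) - ∫ x, f x ∂(ν T y) |
      MeasurableSpace.comap (Z T) MeasurableSpace.pi]) y| ∂(ProbabilityTheory.cond (μ T) (E T)) ≤ δ

/-- The p-values `p T` are asymptotically valid given `E T`: for all `x ≥ 0` the limit superior of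
the conditional probability of `p T ≤ x` is at most `x`; and they are asymptotically uniformly
distributed on `[0, 1]`: for `x ∈ [0, 1]` these conditional probabilities converge to `x`. -/
def AsymptoticallyValidGiven (μ : ∀ T : ℕ, Measure (Fin T → ℝ)) (E : ∀ T : ℕ, Set (Fin T → ℝ))
    (p : ∀ T : ℕ, (Fin T → ℝ) → ℝ) : Prop :=
  (∀ x ≥ 0, ∀ δ > 0, ∀ᶠ T in atTop,
    (ProbabilityTheory.cond (μ T) (E T)).real {y | p T y ≤ x} ≤ x + δ) ∧
  (∀ x ∈ Set.Icc (0 : ℝ) 1, Tendsto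
    (fun T => (ProbabilityTheory.cond (μ T) (E T)).real {y | p T y ≤ x}) atTop (𝓝 x))

end

end WeightedLasso

/-!
The statistic `ηᵀ Y` divided by its true standard deviation is denoted by `U`; under the null
hypothesis it is standard normal, and it is independent of `z` because `z` is the component of `Y`
orthogonal to `η` (`map_resid_standardized`). By the first order conditions of the LASSO, the
selection of `(M, s)` is the polyhedron `A Y < b` up to a null set
(`mem_selectionEvent_of_constraints`, `constraints_of_mem_selectionEvent`). The boundary of the
polyhedron is null because it lies on hyperplanes, except for zero rows of `A`. For these, uniqueness
of the minimizer forces a strict inequality: otherwise moving along a linear relation between an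
inactive column and the selected ones would change neither the fit nor the penalty. Hence, given the
selected signs and `z`, the event confines `U` to an interval `C`, and `U` has the standard normal
law truncated to `C` (`isTruncationModel`). With a known variance everything would therefore be
exact: centred test functions have conditional expectation zero
(`IsTruncationModel.condExp_centred`) and the p-values are uniform
(`IsTruncationModel.measureReal_pvalue_le`).

With an estimated variance, `Q = r U` and `Ω = r C` for the ratio `r = σ / σ̂`, which tends to `1` in
probability. No rate is available, while `C` may be arbitrarily far away from zero, so the passage
from `r` to `1` has to be uniform over all intervals `C`. It rests on one inequality. If `c` is the
point of `C` nearest to zero, then integrating the derivative of `(u - c) φ(u)` over `C` gives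
`E[U (U - c)] ≤ 1` (`integral_quadratic_truncNormal_le`). Since `U (U - c) = (U - c)² + c (U - c)`
with two nonnegative summands, `U` lies within `O(1)` of `c`, and within `O(1 / |c|)` if `|c|` is
large; and since `(U² - c²) / 2 ≤ U (U - c)`, the exponential tilt by which the rescaled truncated
law differs from the original one is `O(|r² - 1|)` in total variation
(`abs_integral_truncNormal_scaled_sub_le`). The second fact settles the p-values
(`eventually_abs_cdf_sub_scaled_le`). For Lipschitz test functions
(`eventually_abs_sub_scaled_le`), rescaling moves the points of `C` little if `|c|` is bounded, and
if `|c|` is large then both `Q` and the law `TN_Ω` concentrate at `r c`.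
-/

namespace WeightedLasso

noncomputable section

/-! ### Intervals and second moments of truncated normal laws -/

/-- The real points of the interval `[a, b]` with extended real endpoints. -/
def realIcc (a b : EReal) : Set ℝ := {t | a ≤ (t : EReal) ∧ (t : EReal) ≤ b}

/-- The point of the interval `[a, b]` nearest to zero, if this interval contains a real number. -/
def nearest (a b : EReal) : ℝ := (max a (min b 0)).toReal

lemma measurableSet_realIcc (a b : EReal) : MeasurableSet (realIcc a b) :=
  (measurableSet_le measurable_const measurable_coe_real_ereal).inter
    (measurableSet_le measurable_coe_real_ereal measurable_const)

lemma coe_nearest {a b : EReal} (h : (realIcc a b).Nonempty) :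
    (nearest a b : EReal) = max a (min b 0) := by
  obtain ⟨t, ha, hb⟩ := h
  refine EReal.coe_toReal (ne_of_lt ?_) (ne_of_gt ?_)
  · exact max_lt (ha.trans_lt (EReal.coe_lt_top t))
      ((min_le_right _ _).trans_lt EReal.zero_lt_top)
  · exact lt_max_of_lt_right (lt_min ((EReal.bot_lt_coe t).trans_le hb) EReal.bot_lt_zero)

lemma nearest_mem {a b : EReal} (h : (realIcc a b).Nonempty) : nearest a b ∈ realIcc a b := by
  have hc := coe_nearest h
  obtain ⟨t, ha, hb⟩ := h
  refine ⟨?_, ?_⟩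
  · rw [hc]; exact le_max_left _ _
  · rw [hc]; exact max_le (ha.trans hb) (min_le_left _ _)

/-- The variational characterization of the projection of zero to a convex set. -/
lemma nearest_mul_sub_nonneg {a b : EReal} {u : ℝ} (hu : u ∈ realIcc a b) :
    0 ≤ nearest a b * (u - nearest a b) := by
  have hc := coe_nearest ⟨u, hu⟩
  rcases lt_trichotomy (nearest a b) 0 with h | h | h
  · have h1 : max a (min b 0) < 0 := by rw [← hc]; exact_mod_cast h
    have h2 : min b 0 = b := by
      apply min_eq_left
      by_contra! h3
      rw [min_eq_right h3.le] at h1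
      exact absurd (le_max_right a 0) (not_le.2 h1)
    have h3 : (u : EReal) ≤ nearest a b := by
      rw [hc, h2]; exact hu.2.trans (le_max_right _ _)
    have h4 : u ≤ nearest a b := by exact_mod_cast h3
    exact mul_nonneg_of_nonpos_of_nonpos h.le (by linarith)
  · simp [h]
  · have h1 : 0 < max a (min b 0) := by rw [← hc]; exact_mod_cast h
    have h2 : max a (min b 0) = a := by
      apply max_eq_left
      by_contra! h3
      rw [max_eq_right h3.le] at h1
      exact absurd (min_le_right b 0) (not_le.2 h1)
    have h3 : (nearest a b : EReal) ≤ u := by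
      rw [hc, h2]; exact hu.1
    have h4 : nearest a b ≤ u := by exact_mod_cast h3
    exact mul_nonneg h.le (by linarith)

lemma hasDerivAt_gaussianPDFReal (u : ℝ) :
    HasDerivAt (gaussianPDFReal 0 1) (-u * gaussianPDFReal 0 1 u) u := by
  have h : HasDerivAt (fun x : ℝ => -(x - 0) ^ 2 / (2 * ((1 : ℝ≥0) : ℝ))) (-u) u :=
    (((((hasDerivAt_id' u).sub_const 0).fun_pow 2).fun_neg).div_const
      (2 * ((1 : ℝ≥0) : ℝ))).congr_deriv (by norm_num; ring)
  refine ((h.exp).const_mul (√(2 * Real.pi * ((1 : ℝ≥0) : ℝ)))⁻¹).congr_deriv ?_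
  rw [gaussianPDFReal_def]; ring

lemma integrable_quadratic_gaussian (c : ℝ) :
    Integrable (fun u : ℝ => u * (u - c)) (gaussianReal 0 1) := by
  have h2 : Integrable (fun u : ℝ => u ^ 2) (gaussianReal 0 1) :=
    (memLp_id_gaussianReal' 2 (by simp)).integrable_sq
  have h1 : Integrable (fun u : ℝ => u) (gaussianReal 0 1) :=
    memLp_one_iff_integrable.1 (memLp_id_gaussianReal' 1 (by simp))
  refine (h2.sub (h1.const_mul c)).congr (Eventually.of_forall fun u => ?_)
  simp only [Pi.sub_apply]; ring

/-- Integration by parts: the derivative of `(u - c) φ(u)` is `(1 - u (u - c)) φ(u)`, and the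
boundary terms have the favourable sign. -/
lemma setIntegral_Icc_quadratic_le {a b c : ℝ} (hac : a ≤ c) (hcb : c ≤ b) :
    ∫ u in Set.Icc a b, u * (u - c) ∂(gaussianReal 0 1) ≤
      (gaussianReal 0 1).real (Set.Icc a b) := by
  have hd : ∀ u ∈ Set.uIcc a b, HasDerivAt (fun u => (u - c) * gaussianPDFReal 0 1 u)
      (gaussianPDFReal 0 1 u * (1 - u * (u - c))) u := by
    intro u _
    exact (((hasDerivAt_id' u).sub_const c).mul (hasDerivAt_gaussianPDFReal u)).congr_deriv
      (by ring)
  have hcont : Continuous fun u => gaussianPDFReal 0 1 u * (1 - u * (u - c)) := by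
    have : Continuous (gaussianPDFReal 0 1) :=
      continuous_iff_continuousAt.2 fun u => (hasDerivAt_gaussianPDFReal u).continuousAt
    fun_prop
  have hftc := intervalIntegral.integral_eq_sub_of_hasDerivAt hd
    (hcont.intervalIntegrable a b)
  have hpos : 0 ≤ ∫ u in Set.Icc a b, (1 - u * (u - c)) ∂(gaussianReal 0 1) := by
    rw [← integral_indicator measurableSet_Icc,
      integral_gaussianReal_eq_integral_smul one_ne_zero]
    have : (fun x => gaussianPDFReal 0 1 x • (Set.Icc a b).indicator
        (fun u => (1 - u * (u - c))) x) =
        (Set.Icc a b).indicator (fun x => gaussianPDFReal 0 1 x * (1 - x * (x - c))) := by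
      funext x
      by_cases hx : x ∈ Set.Icc a b <;> simp [hx]
    rw [this, integral_indicator measurableSet_Icc, integral_Icc_eq_integral_Ioc,
      ← intervalIntegral.integral_of_le (hac.trans hcb), hftc]
    have h1 := gaussianPDFReal_nonneg 0 1 a
    have h2 := gaussianPDFReal_nonneg 0 1 b
    nlinarith [mul_nonneg (sub_nonneg.2 hcb) h2, mul_nonneg (sub_nonneg.2 hac) h1]
  rw [integral_sub (integrable_const _) (integrable_quadratic_gaussian c).integrableOn] at hpos
  simp at hpos
  linarith

lemma realIcc_inter_Icc {a b : EReal} {c n : ℝ} (hc : c ∈ realIcc a b) (hn : |c| ≤ n) :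
    ∃ a' b' : ℝ, a' ≤ c ∧ c ≤ b' ∧ realIcc a b ∩ Set.Icc (-n) n = Set.Icc a' b' := by
  obtain ⟨hn1, hn2⟩ := abs_le.1 hn
  have ha : ((max a (-n : ℝ)).toReal : EReal) = max a (-n : ℝ) :=
    EReal.coe_toReal (ne_of_lt (max_lt (hc.1.trans_lt (EReal.coe_lt_top c)) (EReal.coe_lt_top _)))
      (ne_of_gt (lt_max_of_lt_right (EReal.bot_lt_coe _)))
  have hb : ((min b (n : ℝ)).toReal : EReal) = min b (n : ℝ) :=
    EReal.coe_toReal (ne_of_lt (min_lt_of_right_lt (EReal.coe_lt_top _)))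
      (ne_of_gt (lt_min ((EReal.bot_lt_coe c).trans_le hc.2) (EReal.bot_lt_coe _)))
  refine ⟨(max a (-n : ℝ)).toReal, (min b (n : ℝ)).toReal, ?_, ?_, ?_⟩
  · rw [← EReal.coe_le_coe_iff, ha]
    exact max_le hc.1 (EReal.coe_le_coe_iff.2 hn1)
  · rw [← EReal.coe_le_coe_iff, hb]
    exact le_min hc.2 (EReal.coe_le_coe_iff.2 hn2)
  · ext t
    simp only [realIcc, Set.mem_inter_iff, Set.mem_ofPred_eq, Set.mem_Icc]
    rw [← EReal.coe_le_coe_iff (x := (max a (-n : ℝ)).toReal), ha,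
      ← EReal.coe_le_coe_iff (y := (min b (n : ℝ)).toReal), hb, max_le_iff, le_min_iff,
      EReal.coe_le_coe_iff, EReal.coe_le_coe_iff]
    tauto

lemma setIntegral_realIcc_quadratic_le {a b : EReal} {c : ℝ} (hc : c ∈ realIcc a b) :
    ∫ u in realIcc a b, u * (u - c) ∂(gaussianReal 0 1) ≤
      (gaussianReal 0 1).real (realIcc a b) := by
  have hmono : Monotone fun n : ℕ => realIcc a b ∩ Set.Icc (-(n : ℝ)) n := by
    intro k n hkn
    have : (k : ℝ) ≤ n := by exact_mod_cast hkn
    exact Set.inter_subset_inter_right _ (Set.Icc_subset_Icc (by linarith) this)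
  have hU : (⋃ n : ℕ, realIcc a b ∩ Set.Icc (-(n : ℝ)) n) = realIcc a b := by
    rw [← Set.inter_iUnion]
    refine Set.inter_eq_left.2 fun t _ => ?_
    obtain ⟨n, hn⟩ := exists_nat_ge |t|
    exact Set.mem_iUnion.2 ⟨n, abs_le.1 hn⟩
  have hlim := tendsto_setIntegral_of_monotone (μ := gaussianReal 0 1)
    (f := fun u => u * (u - c))
    (fun n : ℕ => (measurableSet_realIcc a b).inter (measurableSet_Icc (a := -(n : ℝ)) (b := n)))
    hmono (integrable_quadratic_gaussian c).integrableOn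
  rw [hU] at hlim
  refine le_of_tendsto hlim ?_
  obtain ⟨N, hN⟩ := exists_nat_ge |c|
  filter_upwards [eventually_ge_atTop N] with n hn
  obtain ⟨a', b', h1, h2, h3⟩ := realIcc_inter_Icc hc (hN.trans (Nat.cast_le.2 hn))
  rw [h3]
  refine (setIntegral_Icc_quadratic_le h1 h2).trans ?_
  rw [← h3]
  exact measureReal_mono Set.inter_subset_left

/-! ### Scaling of truncated normal laws -/

lemma isProbabilityMeasure_truncNormal {C : Set ℝ} (hC : gaussianReal 0 1 C ≠ 0) :
    IsProbabilityMeasure (truncNormal C) :=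
  cond_isProbabilityMeasure hC

lemma truncNormal_absolutelyContinuous (C : Set ℝ) : truncNormal C ≪ gaussianReal 0 1 :=
  cond_absolutelyContinuous

lemma integral_truncNormal (C : Set ℝ) (g : ℝ → ℝ) :
    ∫ x, g x ∂(truncNormal C) =
      ((gaussianReal 0 1).real C)⁻¹ * ∫ x in C, g x ∂(gaussianReal 0 1) := by
  rw [truncNormal, ProbabilityTheory.cond, integral_smul_measure, ENNReal.toReal_inv, smul_eq_mul,
    Measure.real]

lemma integrable_quadratic_truncNormal {C : Set ℝ} (hC : gaussianReal 0 1 C ≠ 0) (c : ℝ) :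
    Integrable (fun u => u * (u - c)) (truncNormal C) :=
  (integrable_quadratic_gaussian c).integrableOn.smul_measure (ENNReal.inv_ne_top.2 hC)

lemma ae_mem_truncNormal (a b : EReal) : ∀ᵐ u ∂(truncNormal (realIcc a b)), u ∈ realIcc a b :=
  ae_cond_mem (measurableSet_realIcc a b)

lemma nonempty_of_gaussian_ne_zero {C : Set ℝ} (hC : gaussianReal 0 1 C ≠ 0) : C.Nonempty :=
  nonempty_of_measure_ne_zero hC

/-- Under a truncated standard normal distribution, the second moment about the point `c` of the
truncation interval nearest to zero, and `|c|` times the first absolute moment about `c`, are at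
most `1`, however far away the interval is: both are bounded by this integral. -/
lemma integral_quadratic_truncNormal_le {a b : EReal}
    (hC : gaussianReal 0 1 (realIcc a b) ≠ 0) :
    ∫ u, u * (u - nearest a b) ∂(truncNormal (realIcc a b)) ≤ 1 := by
  rw [integral_truncNormal]
  have h0 : 0 < (gaussianReal 0 1).real (realIcc a b) :=
    ENNReal.toReal_pos hC (measure_ne_top _ _)
  rw [inv_mul_le_iff₀ h0, mul_one]
  exact setIntegral_realIcc_quadratic_le (nearest_mem (nonempty_of_gaussian_ne_zero hC))

/-- Change of variables between `N(0, 1)` and `N(0, r⁻²)`. -/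
lemma integral_comp_div_gaussian {r : ℝ} (hr : 0 < r) (G : ℝ → ℝ) :
    ∫ t, G (t / r) ∂(gaussianReal 0 1) =
      r * ∫ w, Real.exp (-((r ^ 2 - 1) * w ^ 2 / 2)) * G w ∂(gaussianReal 0 1) := by
  rw [integral_gaussianReal_eq_integral_smul one_ne_zero,
    integral_gaussianReal_eq_integral_smul one_ne_zero]
  have h := Measure.integral_comp_div (fun w => gaussianPDFReal 0 1 (r * w) * G w) r
  have h1 : (fun t => gaussianPDFReal 0 1 t • G (t / r)) =
      fun t => (fun w => gaussianPDFReal 0 1 (r * w) * G w) (t / r) := by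
    funext t
    simp only [smul_eq_mul]
    rw [mul_div_cancel₀ _ hr.ne']
  rw [h1, h, abs_of_pos hr, smul_eq_mul]
  congr 1
  refine integral_congr_ae (Eventually.of_forall fun w => ?_)
  simp only [smul_eq_mul]
  rw [← mul_assoc]
  congr 1
  simp only [gaussianPDFReal_def]
  rw [mul_assoc (√(2 * Real.pi * ((1 : ℝ≥0) : ℝ)))⁻¹, ← Real.exp_add]
  congr 2
  simp; ring

/-- Exponential tilting by `exp (-ε D)` moves a probability measure by `O(ε)` in total variation if
`D ≥ 0` has a bounded mean. -/
lemma abs_integral_tilt_sub_le {P : Measure ℝ} [IsProbabilityMeasure P] {D G : ℝ → ℝ} {ε : ℝ}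
    (hDm : Measurable D) (hD0 : ∀ᵐ u ∂P, 0 ≤ D u) (hDi : Integrable D P) (hD1 : ∫ u, D u ∂P ≤ 1)
    (hGm : Measurable G) (hG : ∀ u, |G u| ≤ 1) (h0 : 0 ≤ ε) (h1 : ε ≤ 1 / 2) :
    |(∫ u, Real.exp (-(ε * D u)) ∂P)⁻¹ * ∫ u, Real.exp (-(ε * D u)) * G u ∂P - ∫ u, G u ∂P| ≤
      4 * ε := by
  set L : ℝ → ℝ := fun u => Real.exp (-(ε * D u)) with hL
  have hLm : Measurable L := by fun_prop
  have hL1 : ∀ᵐ u ∂P, L u ≤ 1 := by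
    filter_upwards [hD0] with u hu
    exact Real.exp_le_one_iff.2 (by nlinarith)
  have hL2 : ∀ u, 1 - ε * D u ≤ L u := fun u => by
    have := Real.add_one_le_exp (-(ε * D u))
    simp only [hL]; linarith
  have hLi : Integrable L P := by
    refine Integrable.of_bound hLm.aestronglyMeasurable 1 ?_
    filter_upwards [hL1] with u hu
    rwa [Real.norm_eq_abs, abs_of_pos (Real.exp_pos _)]
  have hGi : Integrable G P :=
    Integrable.of_bound hGm.aestronglyMeasurable 1 (Eventually.of_forall hG)
  have hLGi : Integrable (fun u => L u * G u) P := by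
    refine hLi.mono (hLm.mul hGm).aestronglyMeasurable (Eventually.of_forall fun u => ?_)
    rw [norm_mul]
    exact mul_le_of_le_one_right (norm_nonneg _) (hG u)
  have hdi : Integrable (fun u => ε * D u) P := hDi.const_mul ε
  have hZ1 : ∫ u, L u ∂P ≤ 1 := by
    calc ∫ u, L u ∂P ≤ ∫ _, (1 : ℝ) ∂P := integral_mono_ae hLi (integrable_const _) hL1
      _ = 1 := by simp
  have hZ2 : 1 - ε ≤ ∫ u, L u ∂P := by
    calc 1 - ε ≤ ∫ u, (1 - ε * D u) ∂P := by
          rw [integral_sub (integrable_const _) hdi, integral_const_mul]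
          simp; nlinarith
      _ ≤ _ := integral_mono ((integrable_const _).sub hdi) hLi hL2
  have hA : |∫ u, L u * G u ∂P - ∫ u, G u ∂P| ≤ ε := by
    rw [← integral_sub hLGi hGi]
    calc |∫ u, (L u * G u - G u) ∂P| ≤ ∫ u, |L u * G u - G u| ∂P := abs_integral_le_integral_abs
      _ ≤ ∫ u, ε * D u ∂P := by
          refine integral_mono_ae (hLGi.sub hGi).abs hdi ?_
          filter_upwards [hL1] with u hu
          have : L u * G u - G u = (L u - 1) * G u := by ring
          rw [this, abs_mul, abs_of_nonpos (by linarith)]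
          have h3 := hG u
          have h4 := hL2 u
          nlinarith [abs_nonneg (G u)]
      _ ≤ ε := by rw [integral_const_mul]; nlinarith
  have hB : |∫ u, G u ∂P| ≤ 1 := by
    refine abs_integral_le_integral_abs.trans ?_
    calc ∫ u, |G u| ∂P ≤ ∫ _, (1 : ℝ) ∂P := integral_mono hGi.abs (integrable_const _) hG
      _ = 1 := by simp
  set Z := ∫ u, L u ∂P
  set A := ∫ u, L u * G u ∂P
  set B := ∫ u, G u ∂P
  have hZ0 : 0 < Z := by linarith
  have h5 : Z⁻¹ * A - B = Z⁻¹ * ((A - B) + (1 - Z) * B) := by field_simp; ring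
  rw [h5, abs_mul, abs_of_pos (inv_pos.2 hZ0), inv_mul_le_iff₀ hZ0]
  calc |A - B + (1 - Z) * B| ≤ |A - B| + |(1 - Z) * B| := abs_add_le _ _
    _ ≤ ε + ε := by
        refine add_le_add hA ?_
        rw [abs_mul, abs_of_nonneg (by linarith)]
        nlinarith [abs_nonneg B]
    _ ≤ Z * (4 * ε) := by nlinarith

lemma sq_sub_sq_nonneg {c u : ℝ} (h : 0 ≤ c * (u - c)) : 0 ≤ (u ^ 2 - c ^ 2) / 2 := by
  nlinarith [sq_nonneg (u - c)]

lemma sq_sub_sq_le {c u : ℝ} : (u ^ 2 - c ^ 2) / 2 ≤ u * (u - c) := by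
  nlinarith [sq_nonneg (u - c)]

lemma setIntegral_gaussian_scaled {C C' : Set ℝ} (hC : MeasurableSet C) (hC' : MeasurableSet C') {r : ℝ}
    (hr : 0 < r) (hCC : ∀ t, t ∈ C' ↔ t / r ∈ C) (g : ℝ → ℝ) :
    ∫ t in C', g t ∂(gaussianReal 0 1) =
      r * ∫ w in C, Real.exp (-((r ^ 2 - 1) * w ^ 2 / 2)) * g (r * w) ∂(gaussianReal 0 1) := by
  rw [← integral_indicator hC', ← integral_indicator hC]
  have h := integral_comp_div_gaussian hr (C.indicator fun w => g (r * w))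
  have h1 : (fun t => C.indicator (fun w => g (r * w)) (t / r)) = C'.indicator g := by
    funext t
    by_cases ht : t ∈ C'
    · rw [Set.indicator_of_mem ht, Set.indicator_of_mem ((hCC t).1 ht), mul_div_cancel₀ _ hr.ne']
    · rw [Set.indicator_of_notMem ht, Set.indicator_of_notMem (fun h => ht ((hCC t).2 h))]
  rw [h1] at h
  rw [h]
  congr 2
  funext w
  by_cases hw : w ∈ C <;> simp [hw]

/-- A standard normal distribution truncated to `r C` is an exponential tilt of `r` times a standard
normal distribution truncated to `C`. -/
lemma integral_truncNormal_scaled_eq {C C' : Set ℝ} (hC : MeasurableSet C)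
    (hC' : MeasurableSet C') (hC0 : gaussianReal 0 1 C ≠ 0) {r : ℝ}
    (hr : 0 < r) (hCC : ∀ t, t ∈ C' ↔ t / r ∈ C) (g : ℝ → ℝ) (c : ℝ) :
    ∫ t, g t ∂(truncNormal C') =
      (∫ u, Real.exp (-((r ^ 2 - 1) * ((u ^ 2 - c ^ 2) / 2))) ∂(truncNormal C))⁻¹ *
        ∫ u, Real.exp (-((r ^ 2 - 1) * ((u ^ 2 - c ^ 2) / 2))) * g (r * u) ∂(truncNormal C) := by
  have key : ∀ g : ℝ → ℝ, ∫ t in C', g t ∂(gaussianReal 0 1) =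
      r * (Real.exp (-((r ^ 2 - 1) * c ^ 2 / 2)) * ((gaussianReal 0 1).real C *
        ∫ u, Real.exp (-((r ^ 2 - 1) * ((u ^ 2 - c ^ 2) / 2))) * g (r * u) ∂(truncNormal C))) := by
    intro g
    have hc : (gaussianReal 0 1).real C ≠ 0 := ENNReal.toReal_ne_zero.2 ⟨hC0, measure_ne_top _ _⟩
    rw [setIntegral_gaussian_scaled hC hC' hr hCC g, integral_truncNormal, mul_inv_cancel_left₀ hc,
      ← integral_const_mul (Real.exp _)]
    congr 2
    funext u
    rw [← mul_assoc, ← Real.exp_add]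
    congr 2
    ring
  have h1 := key fun _ => 1
  simp only [mul_one, integral_const, smul_eq_mul, measureReal_restrict_apply_univ] at h1
  rw [integral_truncNormal C', key g, h1]
  have ha : r ≠ 0 := hr.ne'
  have hb : Real.exp (-((r ^ 2 - 1) * c ^ 2 / 2)) ≠ 0 := (Real.exp_pos _).ne'
  have hc : (gaussianReal 0 1).real C ≠ 0 := ENNReal.toReal_ne_zero.2 ⟨hC0, measure_ne_top _ _⟩
  rw [mul_inv, mul_inv, mul_inv]
  field_simp

lemma abs_integral_truncNormal_scaled_sub_le_of_one_le {a b : EReal} {C' : Set ℝ}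
    (hC' : MeasurableSet C') (hC0 : gaussianReal 0 1 (realIcc a b) ≠ 0) {r : ℝ}
    (hr : 1 ≤ r) (hr2 : r ^ 2 - 1 ≤ 1 / 2) (hCC : ∀ t, t ∈ C' ↔ t / r ∈ realIcc a b) {g : ℝ → ℝ}
    (hgm : Measurable g) (hg : ∀ x, |g x| ≤ 1) :
    |∫ t, g t ∂(truncNormal C') - ∫ u, g (r * u) ∂(truncNormal (realIcc a b))| ≤
      4 * (r ^ 2 - 1) := by
  have := isProbabilityMeasure_truncNormal hC0
  rw [integral_truncNormal_scaled_eq (measurableSet_realIcc a b) hC' hC0 (by linarith) hCC g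
    (nearest a b)]
  have hae := ae_mem_truncNormal a b
  have hq := integrable_quadratic_truncNormal hC0 (nearest a b)
  have h0 : ∀ᵐ u ∂(truncNormal (realIcc a b)), 0 ≤ (u ^ 2 - nearest a b ^ 2) / 2 := by
    filter_upwards [hae] with u hu
    exact sq_sub_sq_nonneg (nearest_mul_sub_nonneg hu)
  have hi : Integrable (fun u => (u ^ 2 - nearest a b ^ 2) / 2) (truncNormal (realIcc a b)) := by
    refine hq.mono (by fun_prop) ?_
    filter_upwards [h0] with u hu
    rw [Real.norm_eq_abs, Real.norm_eq_abs, abs_of_nonneg hu]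
    exact sq_sub_sq_le.trans (le_abs_self _)
  refine abs_integral_tilt_sub_le (by fun_prop) h0 hi ?_ (by fun_prop) (fun u => hg _)
    (by nlinarith) hr2
  exact (integral_mono hi hq fun u => sq_sub_sq_le).trans (integral_quadratic_truncNormal_le hC0)

/-- The family of truncated normal distributions is invariant under scaling up to a small error in
total variation, uniformly over all truncation intervals. -/
lemma abs_integral_truncNormal_scaled_sub_le {a b a' b' : EReal}
    (hC0 : gaussianReal 0 1 (realIcc a b) ≠ 0) {r : ℝ} (hr : 0 < r)
    (hr2 : |r ^ 2 - (r⁻¹) ^ 2| ≤ 1 / 2)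
    (hCC : ∀ t, t ∈ realIcc a' b' ↔ t / r ∈ realIcc a b) {g : ℝ → ℝ}
    (hgm : Measurable g) (hg : ∀ x, |g x| ≤ 1) :
    |∫ t, g t ∂(truncNormal (realIcc a' b')) - ∫ u, g (r * u) ∂(truncNormal (realIcc a b))| ≤
      4 * |r ^ 2 - (r⁻¹) ^ 2| := by
  rcases le_total 1 r with h | h
  · have h1 : r⁻¹ ^ 2 ≤ 1 := pow_le_one₀ (inv_nonneg.2 hr.le) (inv_le_one_of_one_le₀ h)
    have h2 : r ^ 2 - 1 ≤ |r ^ 2 - (r⁻¹) ^ 2| := le_trans (by linarith) (le_abs_self _)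
    exact (abs_integral_truncNormal_scaled_sub_le_of_one_le (measurableSet_realIcc _ _) hC0 h
      (h2.trans hr2) hCC hgm hg).trans (by linarith)
  · have h0 : 1 ≤ r⁻¹ := (one_le_inv₀ hr).2 h
    have h1 : r ^ 2 ≤ 1 := pow_le_one₀ hr.le h
    have h2 : r⁻¹ ^ 2 - 1 ≤ |r ^ 2 - (r⁻¹) ^ 2| := by
      rw [abs_sub_comm]
      exact le_trans (by linarith) (le_abs_self _)
    have hCC' : ∀ t, t ∈ realIcc a b ↔ t / r⁻¹ ∈ realIcc a' b' := by
      intro t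
      rw [hCC, div_inv_eq_mul, mul_div_cancel_right₀ _ hr.ne']
    have hC0' : gaussianReal 0 1 (realIcc a' b') ≠ 0 := by
      intro h3
      have h4 := setIntegral_gaussian_scaled (measurableSet_realIcc a' b') (measurableSet_realIcc a b)
        (inv_pos.2 hr) hCC' (fun _ => 1)
      rw [Measure.restrict_eq_zero.2 h3] at h4
      simp only [integral_const, smul_eq_mul, measureReal_restrict_apply_univ, mul_one,
        integral_zero_measure, mul_zero] at h4
      exact ENNReal.toReal_ne_zero.2 ⟨hC0, measure_ne_top _ _⟩ h4
    have h5 := abs_integral_truncNormal_scaled_sub_le_of_one_le (measurableSet_realIcc a b) hC0' h0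
      (h2.trans hr2) hCC' (g := fun x => g (r * x)) (by fun_prop) (fun x => hg _)
    simp only [mul_inv_cancel_left₀ hr.ne'] at h5
    rw [abs_sub_comm]
    exact h5.trans (by linarith)

lemma measurable_of_lipschitz {f : ℝ → ℝ} (hf : LipschitzWith 1 f) : Measurable f :=
  hf.continuous.measurable

lemma abs_integral_sub_le {P : Measure ℝ} [IsProbabilityMeasure P] {f g h : ℝ → ℝ}
    (hf : Integrable f P) (hg : Integrable g P) (hh : Integrable h P)
    (hle : ∀ᵐ u ∂P, |f u - g u| ≤ h u) : |∫ u, f u ∂P - ∫ u, g u ∂P| ≤ ∫ u, h u ∂P := by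
  rw [← integral_sub hf hg]
  exact abs_integral_le_integral_abs.trans (integral_mono_ae (hf.sub hg).abs hh hle)

lemma abs_sub_nearest_le {c u : ℝ} (h : 0 ≤ c * (u - c)) : |u - c| ≤ 1 + u * (u - c) := by
  have : u * (u - c) = (u - c) ^ 2 + c * (u - c) := by ring
  nlinarith [sq_abs (u - c), sq_nonneg (|u - c| - 1)]

/-- Concentration at the nearest point `c` of an interval that is far away from zero. -/
lemma abs_sub_nearest_le_div {c u K : ℝ} (h : 0 ≤ c * (u - c)) (hK : 0 < K) (hc : K < |c|) :
    |u - c| ≤ u * (u - c) / K := by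
  rw [le_div_iff₀ hK]
  have h1 : u * (u - c) = (u - c) ^ 2 + c * (u - c) := by ring
  have h2 : c * (u - c) = |c| * |u - c| := by rw [← abs_mul, abs_of_nonneg h]
  nlinarith [abs_nonneg (u - c), sq_nonneg (u - c)]

/-- Rescaling a truncated normal distribution and its argument by a factor near `1` changes the
centred value of a bounded Lipschitz function little, uniformly over all truncation intervals. If
the interval comes near zero, the law is tight and rescaling moves its points little; if it is far
away, the law concentrates at the nearest point of the interval, and the rescaled law at the
rescaled nearest point. -/
lemma eventually_abs_sub_scaled_le {δ : ℝ} (hδ : 0 < δ) :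
    ∀ᶠ r : ℝ in 𝓝 1, ∀ a b a' b' : EReal, gaussianReal 0 1 (realIcc a b) ≠ 0 →
      (∀ t, t ∈ realIcc a' b' ↔ t / r ∈ realIcc a b) →
      ∀ f : ℝ → ℝ, (∀ x, |f x| ≤ 1) → LipschitzWith 1 f → ∀ u ∈ realIcc a b,
        |(f (r * u) - ∫ x, f x ∂(truncNormal (realIcc a' b'))) -
          (f u - ∫ x, f x ∂(truncNormal (realIcc a b)))| ≤
          δ * (1 + u * (u - nearest a b)) := by
  -- Intervals count as far away if they have distance more than `K` from zero. Their
  -- concentration contributes `3 / K = δ / 2` to the error.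
  obtain ⟨K, hK⟩ : ∃ K : ℝ, K = 6 / δ := ⟨_, rfl⟩
  have hK0 : 0 < K := by rw [hK]; positivity
  have hc1 : ContinuousAt (fun r : ℝ => 4 * |r ^ 2 - (r⁻¹) ^ 2|) 1 := by
    have : ContinuousAt (fun r : ℝ => r⁻¹) 1 := continuousAt_inv₀ one_ne_zero
    fun_prop
  have hc2 : ContinuousAt (fun r : ℝ => |r - 1| * (2 * K + 4)) 1 := by fun_prop
  have e1 : ∀ᶠ r : ℝ in 𝓝 1, 4 * |r ^ 2 - (r⁻¹) ^ 2| < min (δ / 2) 2 :=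
    hc1.eventually_lt_const (by simp [hδ])
  have e2 : ∀ᶠ r : ℝ in 𝓝 1, |r - 1| * (2 * K + 4) < δ / 2 :=
    hc2.eventually_lt_const (by simp [hδ])
  filter_upwards [e1, e2, eventually_gt_nhds (zero_lt_one' ℝ), eventually_lt_nhds (one_lt_two)]
    with r hr1 hr2 hr0 hr3 a b a' b' hC hCC f hf hfl u hu
  obtain ⟨hr1, hr4⟩ := lt_min_iff.1 hr1
  have := isProbabilityMeasure_truncNormal hC
  have hLip : ∀ x y, |f x - f y| ≤ |x - y| := fun x y => by
    simpa [Real.dist_eq] using hfl.dist_le_mul x y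
  have hfm := measurable_of_lipschitz hfl
  have hscale := abs_integral_truncNormal_scaled_sub_le hC hr0 (by linarith) hCC hfm hf
  set P := truncNormal (realIcc a b)
  set c := nearest a b with hcdef
  have hqi : Integrable (fun w => w * (w - c)) P := integrable_quadratic_truncNormal hC c
  have hq1 : ∫ w, w * (w - c) ∂P ≤ 1 := integral_quadratic_truncNormal_le hC
  have hmem : ∀ᵐ w ∂P, w ∈ realIcc a b := ae_mem_truncNormal a b
  have hw0 : ∀ w ∈ realIcc a b, 0 ≤ c * (w - c) := fun w hw => nearest_mul_sub_nonneg hw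
  have hfi : Integrable f P := Integrable.of_bound hfm.aestronglyMeasurable 1
    (Eventually.of_forall hf)
  have hfri : Integrable (fun w => f (r * w)) P :=
    Integrable.of_bound (hfm.comp (measurable_const_mul r)).aestronglyMeasurable 1
      (Eventually.of_forall fun w => hf _)
  have hci : ∀ y : ℝ, Integrable (fun _ => y) P := fun y => integrable_const y
  have hq0 : 0 ≤ u * (u - c) := by
    have : u * (u - c) = (u - c) ^ 2 + c * (u - c) := by ring
    rw [this]; exact add_nonneg (sq_nonneg _) (hw0 u hu)
  set I' := ∫ x, f x ∂(truncNormal (realIcc a' b'))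
  rcases le_or_gt |c| K with hcK | hcK
  · have hpt : ∀ w ∈ realIcc a b, |f (r * w) - f w| ≤ |r - 1| * (K + 1 + w * (w - c)) := by
      intro w hw
      refine (hLip _ _).trans ?_
      have : r * w - w = (r - 1) * w := by ring
      rw [this, abs_mul]
      refine mul_le_mul_of_nonneg_left ?_ (abs_nonneg _)
      have h1 := abs_sub_nearest_le (hw0 w hw)
      have h2 : |w| ≤ |w - c| + |c| := by simpa using abs_add_le (w - c) c
      linarith
    have hint : |∫ w, f (r * w) ∂P - ∫ w, f w ∂P| ≤ |r - 1| * (K + 2) := by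
      refine (abs_integral_sub_le hfri hfi (((hci (K + 1)).add hqi).const_mul |r - 1|)
        (hmem.mono hpt)).trans ?_
      rw [integral_const_mul]
      refine mul_le_mul_of_nonneg_left ?_ (abs_nonneg _)
      simp only [Pi.add_apply]
      rw [integral_add (hci _) hqi]
      simp; linarith
    have h1 := hpt u hu
    have h2 : |(f (r * u) - I') - (f u - ∫ x, f x ∂P)| ≤ |f (r * u) - f u| +
        |I' - ∫ w, f (r * w) ∂P| + |∫ w, f (r * w) ∂P - ∫ w, f w ∂P| := by
      rw [abs_le]
      have := abs_le.1 (le_refl |f (r * u) - f u|)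
      have := abs_le.1 (le_refl |I' - ∫ w, f (r * w) ∂P|)
      have := abs_le.1 (le_refl |∫ w, f (r * w) ∂P - ∫ w, f w ∂P|)
      constructor <;> linarith
    have h3 := abs_nonneg (r - 1)
    have h4 : |r - 1| ≤ δ / 2 := by nlinarith
    have h5 := mul_le_mul_of_nonneg_right h4 hq0
    nlinarith
  · have hpt : ∀ w ∈ realIcc a b, |w - c| ≤ w * (w - c) / K := fun w hw =>
      abs_sub_nearest_le_div (hw0 w hw) hK0 hcK
    have hpt' : ∀ w ∈ realIcc a b, |f (r * w) - f (r * c)| ≤ 2 * (w * (w - c) / K) := by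
      intro w hw
      refine (hLip _ _).trans ?_
      rw [← mul_sub, abs_mul, abs_of_pos hr0]
      exact mul_le_mul hr3.le (hpt w hw) (abs_nonneg _) zero_le_two
    have hqK : ∫ w, w * (w - c) / K ∂P ≤ 1 / K := by
      rw [integral_div]; gcongr
    have i1 : |∫ w, f w ∂P - f c| ≤ 1 / K := by
      have := abs_integral_sub_le hfi (hci (f c)) (hqi.div_const K)
        (hmem.mono fun w hw => (hLip _ _).trans (hpt w hw))
      simp only [integral_const, probReal_univ, one_smul] at this
      exact this.trans hqK
    have i2 : |∫ w, f (r * w) ∂P - f (r * c)| ≤ 2 * (1 / K) := by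
      have := abs_integral_sub_le hfri (hci (f (r * c))) ((hqi.div_const K).const_mul 2)
        (hmem.mono hpt')
      simp only [integral_const, probReal_univ, one_smul] at this
      rw [integral_const_mul] at this
      linarith
    have i3 := (hLip u c).trans (hpt u hu)
    have i4 := hpt' u hu
    have h2 : |(f (r * u) - I') - (f u - ∫ x, f x ∂P)| ≤ |f (r * u) - f (r * c)| +
        |∫ w, f (r * w) ∂P - f (r * c)| + |I' - ∫ w, f (r * w) ∂P| + |f u - f c| +
        |∫ w, f w ∂P - f c| := by
      rw [abs_le]
      have := abs_le.1 (le_refl |f (r * u) - f (r * c)|)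
      have := abs_le.1 (le_refl |∫ w, f (r * w) ∂P - f (r * c)|)
      have := abs_le.1 (le_refl |I' - ∫ w, f (r * w) ∂P|)
      have := abs_le.1 (le_refl |f u - f c|)
      have := abs_le.1 (le_refl |∫ w, f w ∂P - f c|)
      constructor <;> linarith
    have h3 : 1 / K = δ / 6 := by rw [hK]; simp
    have h4 : u * (u - c) / K = δ / 6 * (u * (u - c)) := by rw [← h3]; ring
    rw [h4] at i3 i4
    rw [h3] at i1 i2
    nlinarith

/-- Rescaling a truncated normal law and its argument changes the distribution function little,
uniformly over all truncation intervals. -/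
lemma eventually_abs_cdf_sub_scaled_le {δ : ℝ} (hδ : 0 < δ) :
    ∀ᶠ r : ℝ in 𝓝 1, ∀ a b a' b' : EReal, gaussianReal 0 1 (realIcc a b) ≠ 0 →
      (∀ t, t ∈ realIcc a' b' ↔ t / r ∈ realIcc a b) → ∀ u,
        |(truncNormal (realIcc a' b')).real (Set.Iic (r * u)) -
          (truncNormal (realIcc a b)).real (Set.Iic u)| ≤ δ := by
  have hc1 : ContinuousAt (fun r : ℝ => 4 * |r ^ 2 - (r⁻¹) ^ 2|) 1 := by
    have : ContinuousAt (fun r : ℝ => r⁻¹) 1 := continuousAt_inv₀ one_ne_zero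
    fun_prop
  have e1 : ∀ᶠ r : ℝ in 𝓝 1, 4 * |r ^ 2 - (r⁻¹) ^ 2| < min δ 2 :=
    hc1.eventually_lt_const (by simp [hδ])
  filter_upwards [e1, eventually_gt_nhds (zero_lt_one' ℝ)] with r hr1 hr0 a b a' b' hC hCC u
  obtain ⟨hr1, hr4⟩ := lt_min_iff.1 hr1
  have h := abs_integral_truncNormal_scaled_sub_le hC hr0 (by linarith) hCC
    (g := (Set.Iic (r * u)).indicator 1) (measurable_one.indicator measurableSet_Iic) (fun x => by
      by_cases hx : x ∈ Set.Iic (r * u) <;> simp [hx])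
  have h2 : (fun w => (Set.Iic (r * u)).indicator (1 : ℝ → ℝ) (r * w)) =
      (Set.Iic u).indicator 1 := by
    funext w
    simp [Set.indicator_apply, mul_le_mul_iff_right₀ hr0]
  rw [h2, integral_indicator_one measurableSet_Iic, integral_indicator_one measurableSet_Iic] at h
  linarith

/-! ### The probability integral transform -/

/-- The probability integral transform: the distribution function of a law without atoms is
uniformly distributed under this law. -/
lemma measureReal_cdf_le {P : Measure ℝ} [IsProbabilityMeasure P] [NullSingletonClass P] {x : ℝ}
    (h0 : 0 ≤ x) (h1 : x ≤ 1) : P.real {u | P.real (Set.Iic u) ≤ x} = x := by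
  have hmono : Monotone fun u => P.real (Set.Iic u) := fun u w h =>
    measureReal_mono (Set.Iic_subset_Iic.2 h)
  have hcont : Continuous fun u => P.real (Set.Iic u) := by
    have h : Continuous (cdf P) := by
      refine continuous_iff_continuousAt.2 fun u => ?_
      rw [(monotone_cdf P).continuousAt_iff_leftLim_eq_rightLim, (cdf P).rightLim_eq]
      refine le_antisymm ((monotone_cdf P).leftLim_le le_rfl) ?_
      have h1 := (cdf P).measure_singleton u
      rw [measure_cdf, measure_singleton, eq_comm, ENNReal.ofReal_eq_zero] at h1
      linarith
    rwa [funext (cdf_eq_real P)] at h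
  have htop : Tendsto (fun u => P.real (Set.Iic u)) atTop (𝓝 1) := by
    have := tendsto_cdf_atTop P
    simpa [funext (cdf_eq_real P)] using this
  have hbot : Tendsto (fun u => P.real (Set.Iic u)) atBot (𝓝 0) := by
    have := tendsto_cdf_atBot P
    simpa [funext (cdf_eq_real P)] using this
  have hsurj : ∀ y ∈ Set.Ioo (0 : ℝ) 1, ∃ u, P.real (Set.Iic u) = y := by
    intro y hy
    obtain ⟨u, hu⟩ := (hbot.eventually_lt_const hy.1).exists
    obtain ⟨w, hw⟩ := (htop.eventually_const_lt hy.2).exists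
    exact mem_range_of_exists_le_of_exists_ge hcont ⟨u, hu.le⟩ ⟨w, hw.le⟩
  have hlow : ∀ y ∈ Set.Ioo (0 : ℝ) 1, y ≤ P.real {u | P.real (Set.Iic u) ≤ y} := by
    intro y hy
    obtain ⟨u, hu⟩ := hsurj y hy
    rw [← hu]
    exact measureReal_mono fun w hw => hmono hw
  have hupp : ∀ y ∈ Set.Ioo (0 : ℝ) 1, ∀ x < y, P.real {u | P.real (Set.Iic u) ≤ x} ≤ y := by
    intro y hy x hx
    obtain ⟨u, hu⟩ := hsurj y hy
    rw [← hu]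
    refine measureReal_mono fun w hw => ?_
    by_contra! h
    have h2 : P.real (Set.Iic u) ≤ P.real (Set.Iic w) := hmono (le_of_lt (not_le.1 h))
    rw [hu] at h2
    have h3 : P.real (Set.Iic w) ≤ x := hw
    linarith
  refine le_antisymm ?_ ?_
  · rcases h1.lt_or_eq with h | h
    · refine le_of_forall_gt_imp_ge_of_dense fun y hy => ?_
      rcases lt_or_ge y 1 with hy1 | hy1
      · exact hupp y ⟨h0.trans_lt hy, hy1⟩ x hy
      · exact measureReal_le_one.trans hy1
    · rw [h]; exact measureReal_le_one
  · refine le_of_forall_lt_imp_le_of_dense fun y hy => ?_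
    rcases lt_or_ge 0 y with hy0 | hy0
    · exact (hlow y ⟨hy0, hy.trans_le h1⟩).trans
        (measureReal_mono fun u (hu : _ ≤ y) => hu.trans hy.le)
    · exact hy0.trans measureReal_nonneg

lemma measureReal_cdf_lt {P : Measure ℝ} [IsProbabilityMeasure P] [NullSingletonClass P] {x : ℝ}
    (h0 : 0 ≤ x) (h1 : x ≤ 1) : P.real {u | P.real (Set.Iic u) < x} = x := by
  refine le_antisymm ?_ ?_
  · exact (measureReal_mono fun u (hu : _ < x) => hu.le).trans (measureReal_cdf_le h0 h1).le
  · refine le_of_forall_lt_imp_le_of_dense fun y hy => ?_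
    rcases lt_or_ge y 0 with hy0 | hy0
    · exact hy0.le.trans measureReal_nonneg
    · rw [← measureReal_cdf_le (P := P) hy0 (hy.le.trans h1)]
      exact measureReal_mono fun u (hu : _ ≤ y) => lt_of_le_of_lt hu hy

lemma measurable_cdf (P : Measure ℝ) [IsFiniteMeasure P] :
    Measurable fun u => P.real (Set.Iic u) :=
  Monotone.measurable fun _ _ h => measureReal_mono (Set.Iic_subset_Iic.2 h)

lemma measureReal_one_sub_cdf_le {P : Measure ℝ} [IsProbabilityMeasure P] [NullSingletonClass P]
    {x : ℝ} (h0 : 0 ≤ x) (h1 : x ≤ 1) : P.real {u | 1 - P.real (Set.Iic u) ≤ x} = x := by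
  have h : {u | 1 - P.real (Set.Iic u) ≤ x} = {u | P.real (Set.Iic u) < 1 - x}ᶜ := by
    ext u
    simp only [Set.mem_ofPred_eq, Set.mem_compl_iff, not_lt]
    constructor <;> intro h <;> linarith
  have hm : MeasurableSet {u | P.real (Set.Iic u) < 1 - x} :=
    measurable_cdf P measurableSet_Iio
  rw [h, probReal_compl_eq_one_sub hm, measureReal_cdf_lt (by linarith) (by linarith)]
  ring

lemma measureReal_two_mul_min_cdf_le {P : Measure ℝ} [IsProbabilityMeasure P]
    [NullSingletonClass P] {x : ℝ} (h0 : 0 ≤ x) (h1 : x ≤ 1) :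
    P.real {u | 2 * min (P.real (Set.Iic u)) (1 - P.real (Set.Iic u)) ≤ x} = x := by
  rcases h1.lt_or_eq with h1 | rfl
  · have h : {u | 2 * min (P.real (Set.Iic u)) (1 - P.real (Set.Iic u)) ≤ x} =
        {u | P.real (Set.Iic u) ≤ x / 2} ∪ {u | 1 - P.real (Set.Iic u) ≤ x / 2} := by
      ext u
      simp only [Set.mem_ofPred_eq, Set.mem_union, ← min_le_iff]
      constructor <;> intro h <;> linarith
    have hm : MeasurableSet {u | 1 - P.real (Set.Iic u) ≤ x / 2} :=
      (measurable_cdf P).const_sub 1 measurableSet_Iic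
    have hd : Disjoint {u | P.real (Set.Iic u) ≤ x / 2} {u | 1 - P.real (Set.Iic u) ≤ x / 2} := by
      refine Set.disjoint_left.2 fun u hu hu' => ?_
      simp only [Set.mem_ofPred_eq] at hu hu'
      linarith
    rw [h, measureReal_union hd hm, measureReal_cdf_le (by linarith) (by linarith),
      measureReal_one_sub_cdf_le (by linarith) (by linarith)]
    ring
  · have h : {u | 2 * min (P.real (Set.Iic u)) (1 - P.real (Set.Iic u)) ≤ 1} = Set.univ := by
      refine Set.eq_univ_of_forall fun u => ?_
      have h1 := min_le_left (P.real (Set.Iic u)) (1 - P.real (Set.Iic u))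
      have h2 := min_le_right (P.real (Set.Iic u)) (1 - P.real (Set.Iic u))
      simp only [Set.mem_ofPred_eq]
      linarith
    rw [h]; simp

/-- Without regard to measurability, a sequence of random variables that differs in probability
little from a sequence of uniform ones is asymptotically uniform. -/
lemma asymptoticallyValidGiven_of_uniform {μ : ∀ T : ℕ, Measure (Fin T → ℝ)}
    {E : ∀ T : ℕ, Set (Fin T → ℝ)} {p q : ∀ T : ℕ, (Fin T → ℝ) → ℝ}
    (hP : ∀ᶠ T in atTop, IsProbabilityMeasure (ProbabilityTheory.cond (μ T) (E T)))
    (hq : ∀ᶠ T in atTop, ∀ x : ℝ, 0 ≤ x → x ≤ 1 →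
      (ProbabilityTheory.cond (μ T) (E T)).real {y | q T y ≤ x} = x)
    (hpq : ∀ δ > 0, Tendsto (fun T => (ProbabilityTheory.cond (μ T) (E T)).real
      {y | δ < |p T y - q T y|}) atTop (𝓝 0)) :
    AsymptoticallyValidGiven μ E p := by
  have hupp : ∀ x ≥ 0, ∀ δ > 0, ∀ᶠ T in atTop,
      (ProbabilityTheory.cond (μ T) (E T)).real {y | p T y ≤ x} ≤ x + δ := by
    intro x hx δ hδ
    filter_upwards [hP, hq, (hpq (δ / 2) (by positivity)).eventually_lt_const
      (show (0 : ℝ) < δ / 2 by positivity)] with T hT hqT hd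
    rcases le_or_gt (x + δ / 2) 1 with h | h
    · have hsub : {y | p T y ≤ x} ⊆ {y | q T y ≤ x + δ / 2} ∪ {y | δ / 2 < |p T y - q T y|} := by
        intro y (hy : p T y ≤ x)
        by_contra! hc
        simp only [Set.mem_union, Set.mem_ofPred_eq, not_or, not_le, not_lt] at hc
        have := (abs_le.1 hc.2).1
        linarith [hc.1]
      refine (measureReal_mono hsub).trans ((measureReal_union_le _ _).trans ?_)
      rw [hqT _ (by linarith) h]
      linarith
    · exact measureReal_le_one.trans (by linarith)
  refine ⟨hupp, fun x hx => ?_⟩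
  refine tendsto_order.2 ⟨fun y hy => ?_, fun y hy => ?_⟩
  · have hd0 : 0 < (x - y) / 3 := by linarith
    filter_upwards [hP, hq, (hpq _ hd0).eventually_lt_const hd0] with T hT hqT hd
    rcases lt_or_ge y 0 with h | h
    · exact h.trans_le measureReal_nonneg
    · have hsub : {w | q T w ≤ x - (x - y) / 3} ⊆
          {w | p T w ≤ x} ∪ {w | (x - y) / 3 < |p T w - q T w|} := by
        intro w (hw : q T w ≤ _)
        by_contra! hc
        simp only [Set.mem_union, Set.mem_ofPred_eq, not_or, not_le, not_lt] at hc
        have := (abs_le.1 hc.2).2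
        linarith [hc.1]
      have h2 := (measureReal_mono hsub).trans (measureReal_union_le
        (μ := ProbabilityTheory.cond (μ T) (E T)) _ _)
      rw [hqT _ (by linarith) (by linarith [hx.2])] at h2
      linarith
  · filter_upwards [hupp x hx.1 ((y - x) / 2) (by linarith)] with T hT
    linarith

/-! ### Conditional laws on unions of cells -/

section Cells

variable {Y ι : Type*} [MeasurableSpace Y]

/-- The points `y` with `z y ∈ Z` and `U y` strictly between the bounds `lo (z y)` and
`hi (z y)`. -/
def cell (z : Y → Y) (U : Y → ℝ) (lo hi : Y → EReal) (Z : Set Y) : Set Y :=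
  {y | z y ∈ Z ∧ lo (z y) < (U y : EReal) ∧ (U y : EReal) < hi (z y)}

/-- Under `μ`, the statistic `U` is standard normal and independent of the nuisance statistic `z`,
and up to null sets the event `E` is a disjoint union of cells, on each of which the label
`lab` is constant and `U` is confined to an interval that depends on `z` only. -/
structure IsTruncationModel (μ : Measure Y) (E : Set Y) (z : Y → Y) (U : Y → ℝ) (lab : Y → ι)
    (lo hi : ι → Y → EReal) (Z : ι → Set Y) : Prop where
  measurable_z : Measurable z
  measurable_U : Measurable U
  map_eq : μ.map (fun y => (z y, U y)) = (μ.map z).prod (gaussianReal 0 1)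
  measurable_lo : ∀ s, Measurable (lo s)
  measurable_hi : ∀ s, Measurable (hi s)
  measurableSet_Z : ∀ s, MeasurableSet (Z s)
  restrict_eq : μ.restrict E = Measure.sum fun s => μ.restrict (cell z U (lo s) (hi s) (Z s))
  lab_ae : ∀ s, ∀ᵐ y ∂(μ.restrict (cell z U (lo s) (hi s) (Z s))), lab y = s

lemma measurableSet_cell {z : Y → Y} {U : Y → ℝ} {lo hi : Y → EReal} {Z : Set Y}
    (hz : Measurable z) (hU : Measurable U) (hlo : Measurable lo) (hhi : Measurable hi)
    (hZ : MeasurableSet Z) : MeasurableSet (cell z U lo hi Z) :=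
  (hz hZ).inter ((measurableSet_lt (hlo.comp hz) hU.coe_real_ereal).inter
    (measurableSet_lt hU.coe_real_ereal (hhi.comp hz)))

lemma gaussian_realIcc_ne_zero {a b : EReal} {u : ℝ} (ha : a < u) (hb : (u : EReal) < b) :
    gaussianReal 0 1 (realIcc a b) ≠ 0 := by
  intro h
  have ho : IsOpen {t : ℝ | a < (t : EReal) ∧ (t : EReal) < b} :=
    (isOpen_Ioi.preimage continuous_coe_real_ereal).inter
      (isOpen_Iio.preimage continuous_coe_real_ereal)
  have h0 : volume {t : ℝ | a < (t : EReal) ∧ (t : EReal) < b} = 0 :=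
    gaussianReal_absolutelyContinuous' 0 one_ne_zero
      (measure_mono_null (show _ ⊆ realIcc a b from fun t ht => ⟨ht.1.le, ht.2.le⟩) h)
  exact (ho.measure_pos volume ⟨u, ha, hb⟩).ne' h0

instance : NullSingletonClass (gaussianReal 0 1) := nullSingletonClass_gaussianReal one_ne_zero

instance (C : Set ℝ) : NullSingletonClass (truncNormal C) :=
  ⟨fun x => truncNormal_absolutelyContinuous C (measure_singleton x)⟩

lemma realIcc_ae_eq (a b : EReal) :
    {t : ℝ | a < (t : EReal) ∧ (t : EReal) < b} =ᵐ[gaussianReal 0 1] realIcc a b := by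
  refine ae_eq_set.2 ⟨?_, ?_⟩
  · have h : {t : ℝ | a < (t : EReal) ∧ (t : EReal) < b} ⊆ realIcc a b :=
      fun t ht => ⟨ht.1.le, ht.2.le⟩
    rw [Set.sdiff_eq_empty.2 h, measure_empty]
  · refine measure_mono_null (t := {a.toReal, b.toReal}) ?_ (Set.Finite.measure_zero (by simp) _)
    rintro t ⟨⟨h1, h2⟩, h3⟩
    rcases h1.lt_or_eq with h1 | h1
    · rcases h2.lt_or_eq with h2 | h2
      · exact absurd ⟨h1, h2⟩ h3
      · right; simp [← h2]
    · left; simp [h1]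

lemma measurable_integral_truncNormal {α : Type*} [MeasurableSpace α] {a b : α → EReal}
    (ha : Measurable a) (hb : Measurable b) {g : α × ℝ → ℝ} (hg : Measurable g) :
    Measurable fun x => ∫ t, g (x, t) ∂(truncNormal (realIcc (a x) (b x))) := by
  have hS : MeasurableSet {p : α × ℝ | p.2 ∈ realIcc (a p.1) (b p.1)} :=
    (measurableSet_le (ha.comp measurable_fst) measurable_snd.coe_real_ereal).inter
      (measurableSet_le measurable_snd.coe_real_ereal (hb.comp measurable_fst))
  have key : ∀ g : α × ℝ → ℝ, Measurable g →
      Measurable fun x => ∫ t in realIcc (a x) (b x), g (x, t) ∂(gaussianReal 0 1) := by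
    intro g hg
    have h := ((hg.indicator hS).stronglyMeasurable.integral_prod_right'
      (ν := gaussianReal 0 1)).measurable
    convert h using 2 with x
    rw [← integral_indicator (measurableSet_realIcc _ _)]
    rfl
  have h1 := key (fun _ => 1) measurable_const
  simp only [integral_const, smul_eq_mul, mul_one, measureReal_restrict_apply_univ] at h1
  simp only [integral_truncNormal]
  exact h1.inv.mul (key g hg)

/-- The value of a test function at `U`, centred by its mean under the law of `U` truncated to the
interval of the cell. -/
def centred (z : Y → Y) (U : Y → ℝ) (lab : Y → ι) (lo hi : ι → Y → EReal)
    (f : ℝ → ℝ) (y : Y) : ℝ :=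
  f (U y) - ∫ x, f x ∂(truncNormal (realIcc (lo (lab y) (z y)) (hi (lab y) (z y))))

lemma abs_integral_truncNormal_le (C : Set ℝ) {f : ℝ → ℝ}
    (hf : ∀ x, |f x| ≤ 1) :
    |∫ x, f x ∂(truncNormal C)| ≤ 1 := by
  by_cases hC : gaussianReal 0 1 C = 0
  · have : truncNormal C = 0 := cond_eq_zero_of_meas_eq_zero hC
    simp [this]
  · have := isProbabilityMeasure_truncNormal hC
    have h : ‖∫ x, f x ∂(truncNormal C)‖ ≤ 1 * (truncNormal C).real Set.univ :=
      norm_integral_le_of_norm_le_const (Eventually.of_forall hf)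
    simpa using h

lemma abs_sub_integral_truncNormal_le (C : Set ℝ) {f : ℝ → ℝ}
    (hf : ∀ x, |f x| ≤ 1)
    (t : ℝ) : |f t - ∫ x, f x ∂(truncNormal C)| ≤ 2 := by
  refine (abs_sub _ _).trans ?_
  linarith [hf t, abs_integral_truncNormal_le C hf]

lemma setIntegral_sub_integral_truncNormal {C : Set ℝ} {f : ℝ → ℝ}
    (hfm : Measurable f)
    (hf : ∀ x, |f x| ≤ 1) :
    ∫ u in C, (f u - ∫ x, f x ∂(truncNormal C)) ∂(gaussianReal 0 1) = 0 := by
  by_cases hC : gaussianReal 0 1 C = 0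
  · rw [Measure.restrict_eq_zero.2 hC, integral_zero_measure]
  · have hfi : Integrable f (gaussianReal 0 1) :=
      Integrable.of_bound hfm.aestronglyMeasurable 1 (Eventually.of_forall hf)
    rw [integral_sub hfi.integrableOn (integrable_const _), integral_const, integral_truncNormal,
      smul_eq_mul, measureReal_restrict_apply_univ, mul_inv_cancel_left₀, sub_self]
    exact ENNReal.toReal_ne_zero.2 ⟨hC, measure_ne_top _ _⟩

namespace IsTruncationModel

variable {μ : Measure Y} {E : Set Y} {z : Y → Y} {U : Y → ℝ} {lab : Y → ι}
  {lo hi : ι → Y → EReal} {Z : ι → Set Y}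

lemma measurableSet_graph (H : IsTruncationModel μ E z U lab lo hi Z) (s : ι) :
    MeasurableSet {p : Y × ℝ | p.1 ∈ Z s ∧ lo s p.1 < (p.2 : EReal) ∧ (p.2 : EReal) < hi s p.1} :=
  (measurable_fst (H.measurableSet_Z s)).inter
    ((measurableSet_lt ((H.measurable_lo s).comp measurable_fst) measurable_snd.coe_real_ereal).inter
      (measurableSet_lt measurable_snd.coe_real_ereal ((H.measurable_hi s).comp measurable_fst)))

lemma setLIntegral_cell [IsProbabilityMeasure μ] (H : IsTruncationModel μ E z U lab lo hi Z)
    (s : ι) {F : Y × ℝ → ℝ≥0∞} (hF : Measurable F) :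
    ∫⁻ y in cell z U (lo s) (hi s) (Z s), F (z y, U y) ∂μ =
      ∫⁻ x in Z s, ∫⁻ u in realIcc (lo s x) (hi s x), F (x, u) ∂(gaussianReal 0 1) ∂(μ.map z) := by
  have hz := H.measurable_z
  have hS := H.measurableSet_graph s
  set S := {p : Y × ℝ | p.1 ∈ Z s ∧ lo s p.1 < (p.2 : EReal) ∧ (p.2 : EReal) < hi s p.1}
  have hmem : ∀ x u, (x, u) ∈ S ↔ x ∈ Z s ∧ lo s x < (u : EReal) ∧ (u : EReal) < hi s x :=
    fun _ _ => Iff.rfl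
  have := Measure.isProbabilityMeasure_map (μ := μ) hz.aemeasurable
  rw [← lintegral_indicator (measurableSet_cell hz H.measurable_U (H.measurable_lo s)
    (H.measurable_hi s) (H.measurableSet_Z s)), ← lintegral_indicator (H.measurableSet_Z s)]
  calc _ = ∫⁻ y, S.indicator F (z y, U y) ∂μ := rfl
    _ = ∫⁻ p, S.indicator F p ∂(μ.map fun y => (z y, U y)) :=
        (lintegral_map (hF.indicator hS) (hz.prodMk H.measurable_U)).symm
    _ = ∫⁻ x, ∫⁻ u, S.indicator F (x, u) ∂(gaussianReal 0 1) ∂(μ.map z) := by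
        rw [H.map_eq, lintegral_prod _ (hF.indicator hS).aemeasurable]
    _ = _ := by
        refine lintegral_congr fun x => ?_
        by_cases hx : x ∈ Z s
        · rw [Set.indicator_of_mem hx, ← setLIntegral_congr (realIcc_ae_eq _ _),
            ← lintegral_indicator]
          · refine lintegral_congr fun u => ?_
            classical simp [Set.indicator_apply, hmem, hx]
          · exact (measurableSet_lt measurable_const measurable_coe_real_ereal).inter
              (measurableSet_lt measurable_coe_real_ereal measurable_const)
        · rw [Set.indicator_of_notMem hx]
          simp [hmem, hx]

/-- By Fubini's theorem, an integral over a cell vanishes if it vanishes on each fibre of `z`. -/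
lemma setIntegral_cell_eq_zero [IsProbabilityMeasure μ]
    (H : IsTruncationModel μ E z U lab lo hi Z)
    (s : ι) {G : Y × ℝ → ℝ} (hG : Measurable G) {B : ℝ} (hB : ∀ p, |G p| ≤ B)
    (h0 : ∀ x, ∫ u in realIcc (lo s x) (hi s x), G (x, u) ∂(gaussianReal 0 1) = 0) :
    ∫ y in cell z U (lo s) (hi s) (Z s), G (z y, U y) ∂μ = 0 := by
  have hz := H.measurable_z
  have hS := H.measurableSet_graph s
  set S := {p : Y × ℝ | p.1 ∈ Z s ∧ lo s p.1 < (p.2 : EReal) ∧ (p.2 : EReal) < hi s p.1}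
  have hmem : ∀ x u, (x, u) ∈ S ↔ x ∈ Z s ∧ lo s x < (u : EReal) ∧ (u : EReal) < hi s x :=
    fun _ _ => Iff.rfl
  have := Measure.isProbabilityMeasure_map (μ := μ) hz.aemeasurable
  rw [← integral_indicator (measurableSet_cell hz H.measurable_U (H.measurable_lo s)
    (H.measurable_hi s) (H.measurableSet_Z s))]
  have hSG : Measurable (S.indicator G) := hG.indicator hS
  calc _ = ∫ y, S.indicator G (z y, U y) ∂μ := rfl
    _ = ∫ p, S.indicator G p ∂(μ.map fun y => (z y, U y)) :=
        (integral_map (hz.prodMk H.measurable_U).aemeasurable hSG.aestronglyMeasurable).symm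
    _ = ∫ x, ∫ u, S.indicator G (x, u) ∂(gaussianReal 0 1) ∂(μ.map z) := by
        rw [H.map_eq, integral_prod]
        refine Integrable.of_bound hSG.aestronglyMeasurable B (Eventually.of_forall fun p => ?_)
        exact (norm_indicator_le_norm_self G p).trans (hB p)
    _ = ∫ x, 0 ∂(μ.map z) := by
        refine integral_congr_ae (Eventually.of_forall fun x => ?_)
        by_cases hx : x ∈ Z s
        · refine Eq.trans ?_ (h0 x)
          rw [← setIntegral_congr_set (realIcc_ae_eq _ _), ← integral_indicator]
          · refine integral_congr_ae (Eventually.of_forall fun u => ?_)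
            classical simp [Set.indicator_apply, hmem, hx]
          · exact (measurableSet_lt measurable_const measurable_coe_real_ereal).inter
              (measurableSet_lt measurable_coe_real_ereal measurable_const)
        · simp [hmem, hx]
    _ = 0 := by simp

lemma cond_eq (H : IsTruncationModel μ E z U lab lo hi Z) :
    ProbabilityTheory.cond μ E =
      (μ E)⁻¹ • Measure.sum fun s => μ.restrict (cell z U (lo s) (hi s) (Z s)) := by
  rw [← H.restrict_eq]; rfl

/-- The second moment bound for truncated normal laws, integrated over the cells. -/
lemma lintegral_quadratic_le [IsProbabilityMeasure μ] (H : IsTruncationModel μ E z U lab lo hi Z)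
    (hE : μ E ≠ 0) :
    ∫⁻ y, ENNReal.ofReal (U y * (U y - nearest (lo (lab y) (z y)) (hi (lab y) (z y))))
      ∂(ProbabilityTheory.cond μ E) ≤ 1 := by
  have hle : ∀ s, ∫⁻ y, ENNReal.ofReal (U y * (U y - nearest (lo (lab y) (z y))
      (hi (lab y) (z y)))) ∂(μ.restrict (cell z U (lo s) (hi s) (Z s))) ≤
      ∫⁻ _, 1 ∂(μ.restrict (cell z U (lo s) (hi s) (Z s))) := by
    intro s
    have hm : Measurable fun p : Y × ℝ => p.2 * (p.2 - nearest (lo s p.1) (hi s p.1)) := by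
      have : Measurable fun x => nearest (lo s x) (hi s x) :=
        ((H.measurable_lo s).max ((H.measurable_hi s).min measurable_const)).ereal_toReal
      exact measurable_snd.mul (measurable_snd.sub (this.comp measurable_fst))
    calc _ = ∫⁻ y in cell z U (lo s) (hi s) (Z s),
          ENNReal.ofReal (U y * (U y - nearest (lo s (z y)) (hi s (z y)))) ∂μ := by
          refine lintegral_congr_ae ?_
          filter_upwards [H.lab_ae s] with y hy
          rw [hy]
      _ ≤ _ := by
          rw [H.setLIntegral_cell s hm.ennreal_ofReal,
            H.setLIntegral_cell s (F := fun _ => 1) measurable_const]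
          refine lintegral_mono fun x => ?_
          by_cases hC : gaussianReal 0 1 (realIcc (lo s x) (hi s x)) = 0
          · rw [Measure.restrict_eq_zero.2 hC]; simp
          · have hc := nearest_mem (nonempty_of_gaussian_ne_zero hC)
            simp only
            rw [← ofReal_integral_eq_lintegral_ofReal (integrable_quadratic_gaussian _).integrableOn]
            · rw [lintegral_one, Measure.restrict_apply_univ,
                ← ofReal_measureReal (measure_ne_top _ _)]
              exact ENNReal.ofReal_le_ofReal (setIntegral_realIcc_quadratic_le hc)
            · filter_upwards [ae_restrict_mem (measurableSet_realIcc _ _)] with u hu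
              exact (sq_sub_sq_nonneg (nearest_mul_sub_nonneg hu)).trans sq_sub_sq_le
  calc _ ≤ ∫⁻ _, 1 ∂(ProbabilityTheory.cond μ E) := by
        rw [H.cond_eq, lintegral_smul_measure, lintegral_smul_measure, lintegral_sum_measure,
          lintegral_sum_measure]
        exact mul_le_mul_right (ENNReal.tsum_le_tsum hle) _
    _ ≤ 1 := by
        have := cond_isProbabilityMeasure hE
        simp

variable [Countable ι]

lemma ae_cond {p : Y → Prop} (H : IsTruncationModel μ E z U lab lo hi Z)
    (h : ∀ s, ∀ y ∈ cell z U (lo s) (hi s) (Z s), lab y = s → p y) :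
    ∀ᵐ y ∂(ProbabilityTheory.cond μ E), p y := by
  rw [H.cond_eq]
  refine Measure.ae_smul_measure ?_ _
  rw [Measure.ae_sum_iff]
  intro s
  filter_upwards [H.lab_ae s, ae_restrict_mem (measurableSet_cell H.measurable_z H.measurable_U
    (H.measurable_lo s) (H.measurable_hi s) (H.measurableSet_Z s))] with y h1 h2
  exact h s y h2 h1

lemma ae_mem_and_ne_zero (H : IsTruncationModel μ E z U lab lo hi Z) :
    ∀ᵐ y ∂(ProbabilityTheory.cond μ E),
      U y ∈ realIcc (lo (lab y) (z y)) (hi (lab y) (z y)) ∧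
        gaussianReal 0 1 (realIcc (lo (lab y) (z y)) (hi (lab y) (z y))) ≠ 0 := by
  refine H.ae_cond fun s y hy hs => ?_
  rw [hs]
  exact ⟨⟨hy.2.1.le, hy.2.2.le⟩, gaussian_realIcc_ne_zero hy.2.1 hy.2.2⟩

/-- The label need not be measurable, but it is constant on each of countably many cells. -/
lemma aemeasurable_lab {β : Type*} [MeasurableSpace β]
    (H : IsTruncationModel μ E z U lab lo hi Z) {K : ι → Y → β}
    (hK : ∀ s, Measurable (K s)) :
    AEMeasurable (fun y => K (lab y) y) (ProbabilityTheory.cond μ E) := by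
  rw [H.cond_eq]
  refine AEMeasurable.smul_measure (aemeasurable_sum_measure_iff.2 fun s => ?_) _
  refine ⟨K s, hK s, ?_⟩
  filter_upwards [H.lab_ae s] with y hy
  rw [hy]

/-- Integration against the conditional law given `E`, carried out first over `U`. -/
lemma integral_cond_eq_zero [IsProbabilityMeasure μ]
    (H : IsTruncationModel μ E z U lab lo hi Z) (hE : μ E ≠ 0)
    {G : ι → Y × ℝ → ℝ} (hG : ∀ s, Measurable (G s)) {B : ℝ} (hB : ∀ s p, |G s p| ≤ B)
    (h0 : ∀ s x, ∫ u in realIcc (lo s x) (hi s x), G s (x, u) ∂(gaussianReal 0 1) = 0) :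
    ∫ y, G (lab y) (z y, U y) ∂(ProbabilityTheory.cond μ E) = 0 := by
  have := cond_isProbabilityMeasure hE
  have hi : Integrable (fun y => G (lab y) (z y, U y)) (ProbabilityTheory.cond μ E) := by
    refine Integrable.of_bound (H.aemeasurable_lab (K := fun s y => G s (z y, U y)) fun s =>
      (hG s).comp (H.measurable_z.prodMk H.measurable_U)).aestronglyMeasurable B
      (Eventually.of_forall fun y => hB _ _)
  rw [H.cond_eq] at hi ⊢
  rw [integrable_smul_measure (ENNReal.inv_ne_zero.2 (measure_ne_top _ _))
    (ENNReal.inv_ne_top.2 hE)] at hi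
  rw [integral_smul_measure, integral_sum_measure hi]
  refine smul_eq_zero_of_right _ ?_
  refine (tsum_congr fun s => ?_).trans tsum_zero
  rw [← H.setIntegral_cell_eq_zero s (hG s) (hB s) (h0 s)]
  refine integral_congr_ae ?_
  filter_upwards [H.lab_ae s] with y hy
  rw [hy]

lemma integrable_centred [IsProbabilityMeasure μ] (H : IsTruncationModel μ E z U lab lo hi Z)
    (hE : μ E ≠ 0) {f : ℝ → ℝ} (hfm : Measurable f) (hf : ∀ x, |f x| ≤ 1) :
    Integrable (centred z U lab lo hi f) (ProbabilityTheory.cond μ E) := by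
  have := cond_isProbabilityMeasure hE
  refine Integrable.of_bound (H.aemeasurable_lab (K := fun s y => f (U y) -
    ∫ x, f x ∂(truncNormal (realIcc (lo s (z y)) (hi s (z y))))) fun s => ?_).aestronglyMeasurable 2
    (Eventually.of_forall fun y => abs_sub_integral_truncNormal_le _ hf _)
  exact (hfm.comp H.measurable_U).sub (measurable_integral_truncNormal (g := fun p => f p.2)
    ((H.measurable_lo s).comp H.measurable_z) ((H.measurable_hi s).comp H.measurable_z)
    (hfm.comp measurable_snd))

/-- Given `E` and the nuisance statistic, `U` has a truncated standard normal law: the conditional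
expectation of a centred test function vanishes. -/
lemma condExp_centred [IsProbabilityMeasure μ] (H : IsTruncationModel μ E z U lab lo hi Z)
    (hE : μ E ≠ 0) {f : ℝ → ℝ} (hfm : Measurable f) (hf : ∀ x, |f x| ≤ 1) :
    (ProbabilityTheory.cond μ E)[centred z U lab lo hi f | MeasurableSpace.comap z inferInstance]
      =ᵐ[ProbabilityTheory.cond μ E] 0 := by
  have := cond_isProbabilityMeasure hE
  symm
  refine ae_eq_condExp_of_forall_setIntegral_eq H.measurable_z.comap_le
    (H.integrable_centred hE hfm hf) (fun _ _ _ => integrableOn_zero) ?_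
    aestronglyMeasurable_zero
  rintro _ ⟨A, hA, rfl⟩ _
  have h0 : ∫ y in z ⁻¹' A, (0 : Y → ℝ) y ∂(ProbabilityTheory.cond μ E) = 0 := by simp
  rw [h0, ← integral_indicator (H.measurable_z hA)]
  symm
  set G : ι → Y × ℝ → ℝ := fun s => (Prod.fst ⁻¹' A).indicator fun p =>
    f p.2 - ∫ x, f x ∂(truncNormal (realIcc (lo s p.1) (hi s p.1))) with hG
  refine H.integral_cond_eq_zero hE (G := G) (B := 2) (fun s => ?_) (fun s p => ?_) fun s x => ?_
  · refine Measurable.indicator ?_ (measurable_fst hA)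
    exact (hfm.comp measurable_snd).sub (measurable_integral_truncNormal
      (α := Y × ℝ) (g := fun p => f p.2) ((H.measurable_lo s).comp measurable_fst)
      ((H.measurable_hi s).comp measurable_fst) (hfm.comp measurable_snd))
  · exact (norm_indicator_le_norm_self (fun p : Y × ℝ => f p.2 -
      ∫ x, f x ∂(truncNormal (realIcc (lo s p.1) (hi s p.1)))) p).trans
      (abs_sub_integral_truncNormal_le _ hf _)
  · by_cases hx : x ∈ A
    · simpa [hG, hx] using setIntegral_sub_integral_truncNormal hfm hf
    · simp [hG, hx]

/-- An event has conditional probability `x` given `E` if it has conditional probability `x` on each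
fibre of `z` in each cell. -/
lemma measureReal_cond_eq [IsProbabilityMeasure μ] (H : IsTruncationModel μ E z U lab lo hi Z)
    (hE : μ E ≠ 0) {S : ι → Set (Y × ℝ)} (hS : ∀ s, MeasurableSet (S s)) {x : ℝ} (hx : |x| ≤ 1)
    (h : ∀ s w, (gaussianReal 0 1).real ({u | (w, u) ∈ S s} ∩ realIcc (lo s w) (hi s w)) =
      x * (gaussianReal 0 1).real (realIcc (lo s w) (hi s w))) :
    (ProbabilityTheory.cond μ E).real {y | (z y, U y) ∈ S (lab y)} = x := by
  have := cond_isProbabilityMeasure hE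
  have hind : ∀ s p, |(S s).indicator (fun _ => (1 : ℝ)) p| ≤ 1 := fun s p =>
    (norm_indicator_le_norm_self (fun _ => (1 : ℝ)) p).trans (by simp)
  have h1 := H.integral_cond_eq_zero hE (B := 2)
    (G := fun s p => (S s).indicator (fun _ => (1 : ℝ)) p - x)
    (fun s => (measurable_const.indicator (hS s)).sub_const x)
    (fun s p => (abs_sub _ _).trans (by linarith [hind s p])) (fun s w => ?_)
  · have hm : AEMeasurable (fun y => (S (lab y)).indicator (fun _ => (1 : ℝ)) (z y, U y))
        (ProbabilityTheory.cond μ E) :=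
      H.aemeasurable_lab (K := fun s y => (S s).indicator (fun _ => (1 : ℝ)) (z y, U y)) fun s =>
        (measurable_const.indicator (hS s)).comp (H.measurable_z.prodMk H.measurable_U)
    have hi1 : Integrable (fun y => (S (lab y)).indicator (fun _ => (1 : ℝ)) (z y, U y))
        (ProbabilityTheory.cond μ E) :=
      Integrable.of_bound hm.aestronglyMeasurable 1 (Eventually.of_forall fun y => hind _ _)
    have h2 : (fun y => (S (lab y)).indicator (fun _ => (1 : ℝ)) (z y, U y)) =
        {y | (z y, U y) ∈ S (lab y)}.indicator fun _ => (1 : ℝ) := rfl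
    have hSn : NullMeasurableSet {y | (z y, U y) ∈ S (lab y)} (ProbabilityTheory.cond μ E) := by
      have h3 := hm.nullMeasurableSet_preimage (measurableSet_singleton (1 : ℝ))
      convert h3 using 1
      ext y
      by_cases hy : (z y, U y) ∈ S (lab y) <;> simp [hy]
    rw [integral_sub hi1 (integrable_const x), h2, integral_indicator₀ hSn] at h1
    simp only [integral_const, smul_eq_mul, mul_one, measureReal_restrict_apply_univ,
      probReal_univ, one_mul] at h1
    linarith
  · have hm : MeasurableSet {u | (w, u) ∈ S s} := measurable_prodMk_left (hS s)
    have h2 : (fun u => (S s).indicator (fun _ => (1 : ℝ)) (w, u)) =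
        {u | (w, u) ∈ S s}.indicator fun _ => (1 : ℝ) := rfl
    have hi1 : Integrable (fun u => (S s).indicator (fun _ => (1 : ℝ)) (w, u))
        (gaussianReal 0 1) := by
      rw [h2]; exact (integrable_const _).indicator hm
    rw [integral_sub hi1.integrableOn (integrable_const _), h2, integral_indicator hm,
      Measure.restrict_restrict hm]
    simp only [integral_const, smul_eq_mul, measureReal_restrict_apply_univ, mul_one]
    rw [h, mul_comm, sub_self]

/-- The probability integral transform given `E`. -/
lemma measureReal_pvalue_le [IsProbabilityMeasure μ] (H : IsTruncationModel μ E z U lab lo hi Z)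
    (hE : μ E ≠ 0) {φ : ℝ → ℝ} (hφ : Measurable φ) {x : ℝ}
    (hu : ∀ (P : Measure ℝ) [IsProbabilityMeasure P] [NullSingletonClass P],
      P.real {u | φ (P.real (Set.Iic u)) ≤ x} = x) :
    (ProbabilityTheory.cond μ E).real {y | φ ((truncNormal (realIcc (lo (lab y) (z y))
      (hi (lab y) (z y)))).real (Set.Iic (U y))) ≤ x} = x := by
  have hx : |x| ≤ 1 := by
    rw [← hu (gaussianReal 0 1), abs_of_nonneg measureReal_nonneg]
    exact measureReal_le_one
  have hcm : ∀ s, Measurable fun p : Y × ℝ =>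
      (truncNormal (realIcc (lo s p.1) (hi s p.1))).real (Set.Iic p.2) := by
    intro s
    have h := measurable_integral_truncNormal (α := Y × ℝ)
      (g := {q : (Y × ℝ) × ℝ | q.2 ≤ q.1.2}.indicator fun _ => (1 : ℝ))
      ((H.measurable_lo s).comp measurable_fst) ((H.measurable_hi s).comp measurable_fst)
      (measurable_const.indicator (measurableSet_le measurable_snd
        (measurable_snd.comp measurable_fst)))
    have heq : ∀ p : Y × ℝ, (truncNormal (realIcc (lo s p.1) (hi s p.1))).real (Set.Iic p.2) =
        ∫ t, {q : (Y × ℝ) × ℝ | q.2 ≤ q.1.2}.indicator (fun _ => (1 : ℝ)) (p, t)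
          ∂(truncNormal (realIcc (lo s p.1) (hi s p.1))) := fun p =>
      (integral_indicator_one measurableSet_Iic).symm
    exact (funext heq) ▸ h
  refine H.measureReal_cond_eq hE (S := fun s => {p | φ ((truncNormal (realIcc (lo s p.1)
    (hi s p.1))).real (Set.Iic p.2)) ≤ x})
    (fun s => measurableSet_le (hφ.comp (hcm s)) measurable_const) hx fun s w => ?_
  by_cases hC : gaussianReal 0 1 (realIcc (lo s w) (hi s w)) = 0
  · rw [Measure.real, Measure.real, hC, measure_mono_null Set.inter_subset_right hC]
    simp
  · have := isProbabilityMeasure_truncNormal hC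
    have h1 := hu (truncNormal (realIcc (lo s w) (hi s w)))
    have hc : (gaussianReal 0 1).real (realIcc (lo s w) (hi s w)) ≠ 0 :=
      ENNReal.toReal_ne_zero.2 ⟨hC, measure_ne_top _ _⟩
    nth_rw 1 [truncNormal] at h1
    rw [Measure.real, cond_apply (measurableSet_realIcc _ _), ENNReal.toReal_mul,
      ENNReal.toReal_inv, Set.inter_comm] at h1
    exact ((inv_mul_eq_iff_eq_mul₀ hc).1 h1).trans (mul_comm _ _)

lemma integrable_quadratic [IsProbabilityMeasure μ] (H : IsTruncationModel μ E z U lab lo hi Z)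
    (hE : μ E ≠ 0) :
    Integrable (fun y => U y * (U y - nearest (lo (lab y) (z y)) (hi (lab y) (z y))))
      (ProbabilityTheory.cond μ E) ∧
    ∫ y, U y * (U y - nearest (lo (lab y) (z y)) (hi (lab y) (z y)))
      ∂(ProbabilityTheory.cond μ E) ≤ 1 := by
  have hm : AEMeasurable (fun y => U y * (U y - nearest (lo (lab y) (z y)) (hi (lab y) (z y))))
      (ProbabilityTheory.cond μ E) := by
    refine H.aemeasurable_lab (K := fun s y => U y * (U y - nearest (lo s (z y)) (hi s (z y))))
      fun s => ?_
    have : Measurable fun x => nearest (lo s x) (hi s x) :=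
      ((H.measurable_lo s).max ((H.measurable_hi s).min measurable_const)).ereal_toReal
    exact H.measurable_U.mul (H.measurable_U.sub (this.comp H.measurable_z))
  have h0 : 0 ≤ᵐ[ProbabilityTheory.cond μ E]
      fun y => U y * (U y - nearest (lo (lab y) (z y)) (hi (lab y) (z y))) := by
    filter_upwards [H.ae_mem_and_ne_zero] with y hy
    exact (sq_sub_sq_nonneg (nearest_mul_sub_nonneg hy.1)).trans sq_sub_sq_le
  have hle := H.lintegral_quadratic_le hE
  refine ⟨⟨hm.aestronglyMeasurable, ?_⟩, ?_⟩
  · rw [hasFiniteIntegral_iff_ofReal h0]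
    exact hle.trans_lt ENNReal.one_lt_top
  · rw [integral_eq_lintegral_of_nonneg_ae h0 hm.aestronglyMeasurable]
    exact ENNReal.toReal_le_of_le_ofReal zero_le_one (by simpa using hle)

/-- A statistic that is close to a centred test function outside an event of small probability has
a small conditional expectation given `E` and the nuisance statistic. -/
lemma integral_abs_condExp_le [IsProbabilityMeasure μ]
    (H : IsTruncationModel μ E z U lab lo hi Z) (hE : μ E ≠ 0) {f : ℝ → ℝ} (hfm : Measurable f)
    (hf : ∀ x, |f x| ≤ 1) {g : Y → ℝ} (hg : Integrable g (ProbabilityTheory.cond μ E))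
    (hg2 : ∀ y, |g y| ≤ 2) {N : Set Y} (hN : MeasurableSet N) {δ : ℝ} (hδ : 0 ≤ δ)
    (hgood : ∀ᵐ y ∂(ProbabilityTheory.cond μ E), y ∉ N → |g y - centred z U lab lo hi f y| ≤
      δ * (1 + U y * (U y - nearest (lo (lab y) (z y)) (hi (lab y) (z y))))) :
    ∫ y, |((ProbabilityTheory.cond μ E)[g | MeasurableSpace.comap z inferInstance]) y|
      ∂(ProbabilityTheory.cond μ E) ≤ 4 * (ProbabilityTheory.cond μ E).real N + 2 * δ := by
  have := cond_isProbabilityMeasure hE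
  have hh := H.integrable_centred hE hfm hf
  obtain ⟨hqi, hq1⟩ := H.integrable_quadratic hE
  set P := ProbabilityTheory.cond μ E
  have h1 : P[g | MeasurableSpace.comap z inferInstance] =ᵐ[P]
      P[g - centred z U lab lo hi f | MeasurableSpace.comap z inferInstance] := by
    filter_upwards [condExp_sub hg hh (MeasurableSpace.comap z inferInstance),
      H.condExp_centred hE hfm hf] with y h1 h2
    rw [h1, Pi.sub_apply, h2]; simp
  calc _ = ∫ y, |(P[g - centred z U lab lo hi f | MeasurableSpace.comap z inferInstance]) y| ∂P :=
        integral_congr_ae (h1.mono fun y hy => by simp only [hy])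
    _ ≤ ∫ y, |(g - centred z U lab lo hi f) y| ∂P := MeasureTheory.integral_abs_condExp_le _
    _ ≤ ∫ y, (N.indicator (fun _ => (4 : ℝ)) y + δ * (1 + U y * (U y -
          nearest (lo (lab y) (z y)) (hi (lab y) (z y))))) ∂P := by
        refine integral_mono_ae (hg.sub hh).abs (((integrable_const _).indicator hN).add
          (((integrable_const _).add hqi).const_mul δ)) ?_
        filter_upwards [hgood, H.ae_mem_and_ne_zero] with y hy hmem
        have h0 : 0 ≤ U y * (U y - nearest (lo (lab y) (z y)) (hi (lab y) (z y))) :=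
          (sq_sub_sq_nonneg (nearest_mul_sub_nonneg hmem.1)).trans sq_sub_sq_le
        by_cases hyN : y ∈ N
        · rw [Set.indicator_of_mem hyN]
          refine ((abs_sub _ _).trans (add_le_add (hg2 y)
            (abs_sub_integral_truncNormal_le _ hf _))).trans ?_
          have : 0 ≤ δ * (1 + U y * (U y - nearest (lo (lab y) (z y)) (hi (lab y) (z y)))) :=
            mul_nonneg hδ (by linarith)
          linarith
        · rw [Set.indicator_of_notMem hyN, zero_add]
          exact hy hyN
    _ ≤ _ := by
        have hi1 : Integrable (fun y => 1 + U y * (U y -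
          nearest (lo (lab y) (z y)) (hi (lab y) (z y)))) P := (integrable_const _).add hqi
        rw [integral_add ((integrable_const _).indicator hN) (hi1.const_mul δ),
          integral_indicator_const _ hN, integral_const_mul, integral_add (integrable_const _) hqi]
        simp
        nlinarith

end IsTruncationModel

end Cells

/-! ### Minimizers of the weighted LASSO objective -/

section

variable {T m : ℕ}

lemma invWeight_nonneg (R : Regression T) (i : Fin R.J) : 0 ≤ invWeight R i :=
  ENNReal.toReal_nonneg

lemma objective_add_sub (R : Regression T) (hT : 0 < T) (y : Fin T → ℝ) (b d : Fin R.J → ℝ) :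
    (T : ℝ) * (objective R y (b + d) - objective R y b) =
      1 / 2 * ((R.X *ᵥ d) ⬝ᵥ (R.X *ᵥ d)) - (y - R.X *ᵥ b) ⬝ᵥ (R.X *ᵥ d) +
        penalty R * ∑ i, (|b i + d i| - |b i|) * invWeight R i := by
  have hT' : (T : ℝ) ≠ 0 := by positivity
  have h1 : ∑ t, (y t - (R.X *ᵥ (b + d)) t) ^ 2 = ∑ t, (y t - (R.X *ᵥ b) t) ^ 2 -
      2 * ((y - R.X *ᵥ b) ⬝ᵥ (R.X *ᵥ d)) + (R.X *ᵥ d) ⬝ᵥ (R.X *ᵥ d) := by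
    rw [Matrix.mulVec_add, dotProduct, dotProduct, Finset.mul_sum, ← Finset.sum_sub_distrib,
      ← Finset.sum_add_distrib]
    refine Finset.sum_congr rfl fun t _ => ?_
    simp only [Pi.add_apply, Pi.sub_apply]
    ring
  have h2 : ∑ i, (|b i + d i| - |b i|) * invWeight R i =
      ∑ i, |(b + d) i| * invWeight R i - ∑ i, |b i| * invWeight R i := by
    rw [← Finset.sum_sub_distrib]
    exact Finset.sum_congr rfl fun i _ => by rw [Pi.add_apply]; ring
  rw [h2, objective, objective, h1, penalty]
  field_simp
  ring

lemma dotProduct_mulVec_eq_sum (R : Regression T) (e : Fin T → ℝ) (d : Fin R.J → ℝ) :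
    e ⬝ᵥ (R.X *ᵥ d) = ∑ i, (e ⬝ᵥ R.X.col i) * d i := by
  rw [Matrix.dotProduct_mulVec]
  rfl

/-- Strict Karush-Kuhn-Tucker conditions, together with linearly independent active columns, imply
that a vector is the only minimizer. -/
lemma minimizers_eq_singleton (R : Regression T) (hT : 0 < T) (hlam : 0 < R.lam)
    {y : Fin T → ℝ} {b : Fin R.J → ℝ}
    (hact : ∀ i, b i ≠ 0 → (y - R.X *ᵥ b) ⬝ᵥ R.X.col i =
      penalty R * ((SignType.sign (b i) : ℝ) * invWeight R i))
    (hinact : ∀ i, b i = 0 → |(y - R.X *ᵥ b) ⬝ᵥ R.X.col i| < penalty R * invWeight R i)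
    (hinj : ∀ d : Fin R.J → ℝ, (∀ i, b i = 0 → d i = 0) → R.X *ᵥ d = 0 → d = 0) :
    minimizers R y = {b} := by
  have hT' : (0 : ℝ) < T := by exact_mod_cast hT
  have hL : 0 < penalty R := mul_pos hT' hlam
  set g : Fin R.J → ℝ := fun i => (y - R.X *ᵥ b) ⬝ᵥ R.X.col i with hg
  have hdiff : ∀ d, (T : ℝ) * (objective R y (b + d) - objective R y b) =
      1 / 2 * ((R.X *ᵥ d) ⬝ᵥ (R.X *ᵥ d)) +
        ∑ i, (penalty R * ((|b i + d i| - |b i|) * invWeight R i) - g i * d i) := by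
    intro d
    rw [objective_add_sub R hT, dotProduct_mulVec_eq_sum R (y - R.X *ᵥ b) d,
      Finset.sum_sub_distrib, ← Finset.mul_sum]
    ring
  have hterm : ∀ (d : Fin R.J → ℝ) i,
      0 ≤ penalty R * ((|b i + d i| - |b i|) * invWeight R i) - g i * d i := by
    intro d i
    by_cases hb : b i = 0
    · have h1 := (hinact i hb).le
      have h2 : g i * d i ≤ |g i| * |d i| := by rw [← abs_mul]; exact le_abs_self _
      have h3 := mul_le_mul_of_nonneg_right h1 (abs_nonneg (d i))
      simp only [hb, zero_add, abs_zero, sub_zero]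
      have : |g i| * |d i| ≤ penalty R * invWeight R i * |d i| := h3
      linarith
    · have h1 : g i = _ := hact i hb
      have h2 : (SignType.sign (b i) : ℝ) * b i = |b i| := sign_mul_self (b i)
      have h3 : (SignType.sign (b i) : ℝ) * (b i + d i) ≤ |b i + d i| := by
        refine (le_abs_self _).trans ?_
        rw [abs_mul]
        refine mul_le_of_le_one_left (abs_nonneg _) ?_
        rcases lt_or_gt_of_ne hb with h | h <;> simp [h]
      have h4 : penalty R * ((|b i + d i| - |b i|) * invWeight R i) - g i * d i =
          penalty R * invWeight R i *
            (|b i + d i| - (SignType.sign (b i) : ℝ) * (b i + d i)) := by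
        rw [h1, mul_add, h2]; ring
      rw [h4]
      exact mul_nonneg (mul_nonneg hL.le (invWeight_nonneg R i)) (sub_nonneg.2 h3)
  have hsq : ∀ d, 0 ≤ (R.X *ᵥ d) ⬝ᵥ (R.X *ᵥ d) := fun d =>
    Finset.sum_nonneg fun t _ => mul_self_nonneg _
  ext b'
  obtain ⟨d, rfl⟩ : ∃ d, b' = b + d := ⟨b' - b, by simp⟩
  simp only [Set.mem_singleton_iff, add_eq_left]
  constructor
  · intro hb'
    have h1 : (T : ℝ) * (objective R y (b + d) - objective R y b) ≤ 0 :=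
      mul_nonpos_of_nonneg_of_nonpos hT'.le (sub_nonpos.2 (hb' b))
    rw [hdiff] at h1
    have h2 := Finset.sum_nonneg fun i (_ : i ∈ Finset.univ) => hterm d i
    have h3 : (R.X *ᵥ d) ⬝ᵥ (R.X *ᵥ d) = 0 := le_antisymm (by linarith) (hsq d)
    have h4 : ∑ i, (penalty R * ((|b i + d i| - |b i|) * invWeight R i) - g i * d i) = 0 :=
      le_antisymm (by linarith [hsq d]) h2
    refine hinj d (fun i hi => ?_) (dotProduct_self_eq_zero.1 h3)
    have h5 := (Finset.sum_eq_zero_iff_of_nonneg fun i _ => hterm d i).1 h4 i (Finset.mem_univ i)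
    simp only [hi, zero_add, abs_zero, sub_zero] at h5
    by_contra hd
    have h6 := mul_lt_mul_of_pos_right (hinact i hi) (abs_pos.2 hd)
    have h7 : g i * d i ≤ |g i| * |d i| := by rw [← abs_mul]; exact le_abs_self _
    have : |g i| * |d i| < penalty R * invWeight R i * |d i| := h6
    linarith
  · rintro rfl b''
    obtain ⟨d, rfl⟩ : ∃ d, b'' = b + d := ⟨b'' - b, by simp⟩
    have h1 : 0 ≤ (T : ℝ) * (objective R y (b + d) - objective R y b) := by
      rw [hdiff]
      exact add_nonneg (mul_nonneg (by norm_num) (hsq d)) (Finset.sum_nonneg fun i _ => hterm d i)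
    rw [add_zero]
    exact sub_nonneg.1 (nonneg_of_mul_nonneg_right h1 hT')

lemma lasso_of_minimizers_eq {R : Regression T} {y : Fin T → ℝ} {b : Fin R.J → ℝ}
    (h : minimizers R y = {b}) : lasso R y = b := by
  have h' : ∃ b, minimizers R y = {b} := ⟨b, h⟩
  have h2 : lasso R y = h'.choose := by rw [lasso, dif_pos h']
  exact h2.trans (Set.singleton_injective (h.symm.trans h'.choose_spec)).symm

open Classical in
/-- The directional derivative of the penalty `∑ |b_i| / ω_i` in direction `d`, at a vector `b` with
support `M` and signs `s`. -/
def penaltyDeriv (R : Regression T) (M : Fin m ↪ Fin R.J) (s : Fin m → SignType)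
    (d : Fin R.J → ℝ) : ℝ :=
  ∑ k, signWeight R M s k * d (M k) + ∑ i : Inactive R M, invWeight R i * |d i|

open Classical in
lemma sum_eq_selected_add_inactive (R : Regression T) (M : Fin m ↪ Fin R.J) (F : Fin R.J → ℝ) :
    ∑ i, F i = ∑ k, F (M k) + ∑ i : Inactive R M, F i := by
  rw [← Fintype.sum_subtype_add_sum_subtype (fun i => i ∈ Set.range M) F]
  congr 1
  convert (Fintype.sum_equiv (Equiv.ofInjective M M.injective) (fun k => F (M k))
    (fun i => F i.1) fun k => rfl).symm

lemma eventually_abs_add_smul (a d : ℝ) : ∀ᶠ t : ℝ in 𝓝[>] 0,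
    |a + t * d| - |a| = t * if a = 0 then |d| else (SignType.sign a : ℝ) * d := by
  by_cases ha : a = 0
  · filter_upwards [self_mem_nhdsWithin] with t ht
    simp [ha, abs_mul, abs_of_pos (show (0 : ℝ) < t from ht)]
  · have hc : ContinuousAt (fun t : ℝ => a + t * d) 0 := by fun_prop
    refine eventually_nhdsWithin_of_eventually_nhds ?_
    rcases lt_or_gt_of_ne ha with h | h
    · filter_upwards [hc.eventually_lt_const (show a + 0 * d < 0 by simpa using h)] with t ht
      rw [abs_of_neg ht, abs_of_neg h]
      simp [ha, h]
    · filter_upwards [hc.eventually_const_lt (show 0 < a + 0 * d by simpa using h)] with t ht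
      rw [abs_of_pos ht, abs_of_pos h]
      simp [ha, h]

/-- First order conditions at the minimizer. The second one expresses its uniqueness: moving in a
direction in the kernel of the design must increase the penalty. -/
lemma selectionEvent_first_order {R : Regression T} (hT : 0 < T)
    {M : Fin m ↪ Fin R.J} {S : Set (Fin m → SignType)} {y : Fin T → ℝ}
    (hy : y ∈ selectionEvent R M S) (hlam : 0 < R.lam) (d : Fin R.J → ℝ) :
    (y - R.X *ᵥ lasso R y) ⬝ᵥ (R.X *ᵥ d) ≤ penalty R * penaltyDeriv R M (lassoSigns R M y) d ∧
      (R.X *ᵥ d = 0 → d ≠ 0 → 0 < penaltyDeriv R M (lassoSigns R M y) d) := by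
  obtain ⟨hmin, hsupp, -⟩ := hy
  have hT' : (0 : ℝ) < T := by exact_mod_cast hT
  have hL : 0 < penalty R := mul_pos hT' hlam
  set b := lasso R y
  have hbmin : ∀ b', objective R y b ≤ objective R y b' := by
    have : b ∈ minimizers R y := by rw [hmin]; rfl
    exact this
  have hpen : ∀ᶠ t : ℝ in 𝓝[>] 0, ∑ i, (|b i + (t • d) i| - |b i|) * invWeight R i =
      t * penaltyDeriv R M (lassoSigns R M y) d := by
    have h := eventually_all.2 fun i => eventually_abs_add_smul (b i) (d i)
    filter_upwards [h] with t ht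
    rw [sum_eq_selected_add_inactive R M, penaltyDeriv, mul_add, Finset.mul_sum, Finset.mul_sum]
    congr 1
    · refine Finset.sum_congr rfl fun k _ => ?_
      have hk : b (M k) ≠ 0 := (hsupp _).2 ⟨k, rfl⟩
      rw [Pi.smul_apply, smul_eq_mul, ht, if_neg hk, signWeight, lassoSigns]
      ring
    · refine Finset.sum_congr rfl fun i _ => ?_
      have hi : b i.1 = 0 := by
        by_contra h
        exact i.2 ((hsupp _).1 h)
      rw [Pi.smul_apply, smul_eq_mul, ht, if_pos hi]
      ring
  have hdiff : ∀ᶠ t : ℝ in 𝓝[>] 0, (T : ℝ) * (objective R y (b + t • d) - objective R y b) =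
      t * (t * (1 / 2 * ((R.X *ᵥ d) ⬝ᵥ (R.X *ᵥ d))) - (y - R.X *ᵥ b) ⬝ᵥ (R.X *ᵥ d) +
        penalty R * penaltyDeriv R M (lassoSigns R M y) d) := by
    filter_upwards [hpen] with t ht
    rw [objective_add_sub R hT, ht, Matrix.mulVec_smul, smul_dotProduct, dotProduct_smul,
      dotProduct_smul]
    simp only [smul_eq_mul]
    ring
  constructor
  · have hlim : Tendsto (fun t : ℝ => t * (1 / 2 * ((R.X *ᵥ d) ⬝ᵥ (R.X *ᵥ d))) -
        (y - R.X *ᵥ b) ⬝ᵥ (R.X *ᵥ d) + penalty R * penaltyDeriv R M (lassoSigns R M y) d)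
        (𝓝[>] 0) (𝓝 (0 * (1 / 2 * ((R.X *ᵥ d) ⬝ᵥ (R.X *ᵥ d))) -
        (y - R.X *ᵥ b) ⬝ᵥ (R.X *ᵥ d) + penalty R * penaltyDeriv R M (lassoSigns R M y) d)) := by
      refine tendsto_nhdsWithin_of_tendsto_nhds (Continuous.tendsto ?_ 0)
      fun_prop
    have h0 := ge_of_tendsto hlim (b := 0) (by
      filter_upwards [hdiff, self_mem_nhdsWithin] with t ht (ht0 : 0 < t)
      have h1 : 0 ≤ (T : ℝ) * (objective R y (b + t • d) - objective R y b) :=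
        mul_nonneg hT'.le (sub_nonneg.2 (hbmin _))
      rw [ht] at h1
      exact nonneg_of_mul_nonneg_right h1 ht0)
    linarith
  · intro hX hd
    obtain ⟨t, ht, ht0⟩ := (hdiff.and self_mem_nhdsWithin).exists
    have ht0 : 0 < t := ht0
    have h1 : objective R y b < objective R y (b + t • d) := by
      refine lt_of_le_of_ne (hbmin _) fun heq => ?_
      have h2 : b + t • d ∈ minimizers R y := fun b' => heq ▸ hbmin b'
      rw [hmin] at h2
      have h3 : t • d = 0 := by simpa using h2
      exact hd ((smul_eq_zero.1 h3).resolve_left ht0.ne')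
    have h4 := mul_pos hT' (sub_pos.2 h1)
    rw [ht, hX] at h4
    simp only [dotProduct_zero, mul_zero, sub_zero, zero_add] at h4
    exact pos_of_mul_pos_right (pos_of_mul_pos_right h4 ht0.le) hL.le

end

/-! ### The polyhedral description of the selection event -/

section

variable {T m : ℕ}

/-- The values on `M` of the vector that solves the first order conditions of the LASSO for the
support `M` and the signs `s`. -/
def candidate (R : Regression T) (M : Fin m ↪ Fin R.J) (s : Fin m → SignType)
    (y : Fin T → ℝ) : Fin m → ℝ :=
  pinv R M *ᵥ y -
    penalty R • (((selDesign R M)ᵀ * selDesign R M)⁻¹ *ᵥ signWeight R M s)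

/-- The residual of `candidate`. -/
def candidateResid (R : Regression T) (M : Fin m ↪ Fin R.J) (s : Fin m → SignType)
    (y : Fin T → ℝ) : Fin T → ℝ :=
  y - selDesign R M *ᵥ candidate R M s y

section

variable {R : Regression T} {M : Fin m ↪ Fin R.J}

lemma pinv_mul_selDesign (hG : IsUnit ((selDesign R M)ᵀ * selDesign R M).det) :
    pinv R M * selDesign R M = 1 := by
  rw [pinv, Matrix.mul_assoc, Matrix.nonsing_inv_mul _ hG]

lemma transpose_pinv : (pinv R M)ᵀ =
    selDesign R M * ((selDesign R M)ᵀ * selDesign R M)⁻¹ := by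
  rw [pinv, Matrix.transpose_mul, Matrix.transpose_transpose, Matrix.transpose_nonsing_inv,
    Matrix.transpose_mul, Matrix.transpose_transpose]

lemma candidateResid_eq (s : Fin m → SignType) (y : Fin T → ℝ) :
    candidateResid R M s y = (1 - proj R M) *ᵥ y +
      penalty R • ((pinv R M)ᵀ *ᵥ signWeight R M s) := by
  rw [candidateResid, candidate, Matrix.mulVec_sub, Matrix.mulVec_smul, Matrix.mulVec_mulVec,
    Matrix.mulVec_mulVec, transpose_pinv, Matrix.sub_mulVec, Matrix.one_mulVec, proj]
  abel

lemma transpose_mulVec_candidateResid (hG : IsUnit ((selDesign R M)ᵀ * selDesign R M).det)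
    (s : Fin m → SignType) (y : Fin T → ℝ) :
    (selDesign R M)ᵀ *ᵥ candidateResid R M s y = penalty R • signWeight R M s := by
  rw [candidateResid, candidate, Matrix.mulVec_sub, Matrix.mulVec_mulVec, Matrix.mulVec_sub,
    Matrix.mulVec_smul, Matrix.mulVec_mulVec, Matrix.mulVec_mulVec, pinv, ← Matrix.mul_assoc,
    Matrix.mul_nonsing_inv _ hG, Matrix.one_mul, Matrix.one_mulVec]
  abel

lemma eq_candidate (hG : IsUnit ((selDesign R M)ᵀ * selDesign R M).det) {s : Fin m → SignType}
    {y : Fin T → ℝ} {c : Fin m → ℝ}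
    (h : (selDesign R M)ᵀ *ᵥ (y - selDesign R M *ᵥ c) = penalty R • signWeight R M s) :
    c = candidate R M s y := by
  have h1 := congrArg (fun u => ((selDesign R M)ᵀ * selDesign R M)⁻¹ *ᵥ u) h
  simp only [Matrix.mulVec_sub, Matrix.mulVec_mulVec, Matrix.mulVec_smul] at h1
  rw [Matrix.nonsing_inv_mul _ hG, Matrix.one_mulVec] at h1
  rw [candidate, ← h1, pinv]
  abel

/-- The gaps in the inequalities `A y ≤ b` are those in the first order conditions: for an inactive
covariate they compare the correlation of the residual with the penalty. -/
lemma gap_inl (hL : penalty R ≠ 0) (s : Fin m → SignType) (y : Fin T → ℝ) (i : Inactive R M) :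
    penalty R * (constraintBound R M s (Sum.inl i) -
        (constraintMatrix R M s *ᵥ y) (Sum.inl i)) =
      penalty R * invWeight R i - candidateResid R M s y ⬝ᵥ R.X.col i := by
  have h : candidateResid R M s y ⬝ᵥ R.X.col i =
      ((inactDesign R M)ᵀ *ᵥ candidateResid R M s y) i := dotProduct_comm _ _
  rw [h, candidateResid_eq, Matrix.mulVec_add, Matrix.mulVec_smul, constraintMatrix,
    Matrix.fromRows_mulVec, constraintBound]
  simp only [Sum.elim_inl, Pi.add_apply, Pi.smul_apply, Matrix.smul_mulVec, smul_eq_mul,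
    ← Matrix.mulVec_mulVec]
  field_simp
  ring

lemma gap_inr_inl (hL : penalty R ≠ 0) (s : Fin m → SignType) (y : Fin T → ℝ)
    (i : Inactive R M) :
    penalty R * (constraintBound R M s (Sum.inr (Sum.inl i)) -
        (constraintMatrix R M s *ᵥ y) (Sum.inr (Sum.inl i))) =
      penalty R * invWeight R i + candidateResid R M s y ⬝ᵥ R.X.col i := by
  have h : candidateResid R M s y ⬝ᵥ R.X.col i =
      ((inactDesign R M)ᵀ *ᵥ candidateResid R M s y) i := dotProduct_comm _ _
  rw [h, candidateResid_eq, Matrix.mulVec_add, Matrix.mulVec_smul, constraintMatrix,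
    Matrix.fromRows_mulVec, Matrix.fromRows_mulVec, constraintBound]
  simp only [Sum.elim_inl, Sum.elim_inr, Pi.add_apply, Pi.smul_apply, Matrix.neg_mulVec,
    Pi.neg_apply, Matrix.smul_mulVec, smul_eq_mul, ← Matrix.mulVec_mulVec]
  field_simp
  ring

/-- The gap in the last block of inequalities is positive if and only if the candidate has the
prescribed signs. -/
lemma gap_inr_inr (s : Fin m → SignType) (y : Fin T → ℝ) (k : Fin m) :
    constraintBound R M s (Sum.inr (Sum.inr k)) -
        (constraintMatrix R M s *ᵥ y) (Sum.inr (Sum.inr k)) =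
      (s k : ℝ) * candidate R M s y k := by
  rw [constraintMatrix, Matrix.fromRows_mulVec, Matrix.fromRows_mulVec, constraintBound, candidate]
  simp only [Sum.elim_inr, Pi.sub_apply, Pi.smul_apply, Matrix.neg_mulVec, smul_eq_mul,
    Pi.neg_apply, ← Matrix.mulVec_mulVec, Matrix.mulVec_diagonal]
  ring

lemma mulVec_extend (c : Fin m → ℝ) :
    R.X *ᵥ Function.extend M c 0 = selDesign R M *ᵥ c := by
  funext t
  simp only [Matrix.mulVec, dotProduct, selDesign, Matrix.submatrix_apply, id]
  rw [sum_eq_selected_add_inactive R M]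
  have h : ∀ i : Inactive R M, R.X t i.1 * Function.extend M c 0 i.1 = 0 := fun i => by
    rw [Function.extend_apply' _ _ _ i.2]; simp
  simp [h, M.injective.extend_apply]

lemma selDesign_injective (hG : IsUnit ((selDesign R M)ᵀ * selDesign R M).det) {c : Fin m → ℝ}
    (h : selDesign R M *ᵥ c = 0) : c = 0 := by
  have h1 := congrArg (fun u => pinv R M *ᵥ u) h
  simpa [Matrix.mulVec_mulVec, pinv_mul_selDesign hG] using h1

lemma dotProduct_selDesign_mulVec (e : Fin T → ℝ) (c : Fin m → ℝ) :
    e ⬝ᵥ (selDesign R M *ᵥ c) = ((selDesign R M)ᵀ *ᵥ e) ⬝ᵥ c := by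
  rw [Matrix.dotProduct_mulVec, Matrix.mulVec_transpose]

lemma sign_eq_of_mul_pos {s : SignType} {x : ℝ} (h : 0 < (s : ℝ) * x) : SignType.sign x = s := by
  rcases s with _ | _ | _
  · simp at h
  · have : x < 0 := by simpa using h
    exact sign_neg this
  · have : 0 < x := by simpa using h
    exact sign_pos this

/-- Strict linear constraints imply the selection of `(M, s)`. -/
lemma mem_selectionEvent_of_constraints (hT : 0 < T) (hlam : 0 < R.lam)
    (hG : IsUnit ((selDesign R M)ᵀ * selDesign R M).det) {S : Set (Fin m → SignType)}
    {s : Fin m → SignType} (hs : s ∈ S) {y : Fin T → ℝ}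
    (h : ∀ k, (constraintMatrix R M s *ᵥ y) k < constraintBound R M s k) :
    y ∈ selectionEvent R M S ∧ lassoSigns R M y = s := by
  have hL : 0 < penalty R := mul_pos (by exact_mod_cast hT) hlam
  set c := candidate R M s y with hc
  set b : Fin R.J → ℝ := Function.extend M c 0 with hb
  have hbM : ∀ k, b (M k) = c k := fun k => M.injective.extend_apply _ _ _
  have hb0 : ∀ i, i ∉ Set.range M → b i = 0 := fun i hi => Function.extend_apply' _ _ _ hi
  have hpos : ∀ k, 0 < (s k : ℝ) * c k := fun k => by
    rw [hc, ← gap_inr_inr]; exact sub_pos.2 (h _)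
  have hsign : ∀ k, SignType.sign (c k) = s k := fun k => sign_eq_of_mul_pos (hpos k)
  have hc0 : ∀ k, c k ≠ 0 := fun k hk => by simpa [hk] using hpos k
  have hsupp : ∀ i, b i ≠ 0 ↔ i ∈ Set.range M := by
    intro i
    refine ⟨fun hi => by_contra fun h => hi (hb0 i h), ?_⟩
    rintro ⟨k, rfl⟩
    rw [hbM]; exact hc0 k
  have hres : y - R.X *ᵥ b = candidateResid R M s y := by
    rw [hb, mulVec_extend, candidateResid]
  have hmin : minimizers R y = {b} := by
    refine minimizers_eq_singleton R hT hlam (fun i hi => ?_) (fun i hi => ?_) fun d hd hX => ?_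
    · obtain ⟨k, rfl⟩ := (hsupp i).1 hi
      have h1 := congrFun (transpose_mulVec_candidateResid hG s y) k
      have h2 : candidateResid R M s y ⬝ᵥ R.X.col (M k) =
        ((selDesign R M)ᵀ *ᵥ candidateResid R M s y) k := dotProduct_comm _ _
      rw [hres, h2, h1, hbM, hsign]
      rfl
    · have hi' : i ∉ Set.range M := fun h => (hsupp i).2 h hi
      have h1 := gap_inl hL.ne' s y ⟨i, hi'⟩
      have h2 := gap_inr_inl hL.ne' s y ⟨i, hi'⟩
      have h3 := mul_pos hL (sub_pos.2 (h (Sum.inl ⟨i, hi'⟩)))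
      have h4 := mul_pos hL (sub_pos.2 (h (Sum.inr (Sum.inl ⟨i, hi'⟩))))
      rw [hres, abs_lt]
      constructor <;> linarith
    · have h1 : d = Function.extend M (fun k => d (M k)) 0 := by
        funext i
        by_cases hi : i ∈ Set.range M
        · obtain ⟨k, rfl⟩ := hi
          rw [M.injective.extend_apply]
        · rw [Function.extend_apply' _ _ _ hi]
          exact hd i (hb0 i hi)
      rw [h1, mulVec_extend] at hX
      have h2 := selDesign_injective hG hX
      rw [h1, h2]
      funext i
      by_cases hi : i ∈ Set.range M
      · obtain ⟨k, rfl⟩ := hi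
        rw [M.injective.extend_apply]; rfl
      · rw [Function.extend_apply' _ _ _ hi]
  have hl := lasso_of_minimizers_eq hmin
  have hls : lassoSigns R M y = s := by
    funext k
    rw [lassoSigns, hl, hbM, hsign]
  refine ⟨⟨?_, fun i => ?_, ?_⟩, hls⟩
  · rw [hl, hmin]
  · rw [hl]; exact hsupp i
  · rw [hls]; exact hs

lemma penaltyDeriv_extend (s : Fin m → SignType) (c : Fin m → ℝ) :
    penaltyDeriv R M s (Function.extend M c 0) = signWeight R M s ⬝ᵥ c := by
  have h : ∀ i : Inactive R M, Function.extend M c 0 i.1 = 0 := fun i =>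
    Function.extend_apply' _ _ _ i.2
  simp [penaltyDeriv, h, M.injective.extend_apply, dotProduct]

lemma penaltyDeriv_single_add_extend (s : Fin m → SignType) (i : Inactive R M) (a : ℝ)
    (c : Fin m → ℝ) :
    penaltyDeriv R M s (Pi.single i.1 a + Function.extend M c 0) =
      signWeight R M s ⬝ᵥ c + invWeight R i * |a| := by
  have h : ∀ i : Inactive R M, Function.extend M c 0 i.1 = 0 := fun i =>
    Function.extend_apply' _ _ _ i.2
  have h2 : ∀ k, (Pi.single i.1 a : Fin R.J → ℝ) (M k) = 0 := fun k =>
    Pi.single_eq_of_ne (fun hk => i.2 ⟨k, hk⟩) _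
  rw [penaltyDeriv, Fintype.sum_eq_single i]
  · simp [h, h2, M.injective.extend_apply, dotProduct]
  · intro i' hi'
    have h3 : (Pi.single i.1 a : Fin R.J → ℝ) i'.1 = 0 :=
      Pi.single_eq_of_ne (fun hk => hi' (Subtype.ext hk)) _
    simp [h, h3]

/-- The selection of `(M, s)` implies the linear constraints, and it implies the strict constraints
for all rows of the constraint matrix that are zero. -/
lemma constraints_of_mem_selectionEvent (hT : 0 < T) (hlam : 0 < R.lam)
    (hG : IsUnit ((selDesign R M)ᵀ * selDesign R M).det) {S : Set (Fin m → SignType)}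
    {y : Fin T → ℝ} (hy : y ∈ selectionEvent R M S) (k : Constraint R M) :
    (constraintMatrix R M (lassoSigns R M y) *ᵥ y) k ≤ constraintBound R M (lassoSigns R M y) k ∧
      ((∀ x, (constraintMatrix R M (lassoSigns R M y) *ᵥ x) k = 0) →
        (constraintMatrix R M (lassoSigns R M y) *ᵥ y) k <
          constraintBound R M (lassoSigns R M y) k) := by
  have hL : 0 < penalty R := mul_pos (by exact_mod_cast hT) hlam
  have hfo := selectionEvent_first_order hT hy hlam
  obtain ⟨hmin, hsupp, -⟩ := hy
  set s := lassoSigns R M y with hs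
  set c : Fin m → ℝ := fun k => lasso R y (M k) with hc
  have hb : lasso R y = Function.extend M c 0 := by
    funext i
    by_cases hi : i ∈ Set.range M
    · obtain ⟨k, rfl⟩ := hi
      rw [M.injective.extend_apply]
    · rw [Function.extend_apply' _ _ _ hi]
      exact by_contra fun h => hi ((hsupp i).1 h)
  have hXb : R.X *ᵥ lasso R y = selDesign R M *ᵥ c := by rw [hb, mulVec_extend]
  rw [hXb] at hfo
  have hact : (selDesign R M)ᵀ *ᵥ (y - selDesign R M *ᵥ c) = penalty R • signWeight R M s := by
    have h1 : ∀ a : Fin m → ℝ, ((selDesign R M)ᵀ *ᵥ (y - selDesign R M *ᵥ c)) ⬝ᵥ a ≤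
        penalty R * (signWeight R M s ⬝ᵥ a) := by
      intro a
      have := (hfo (Function.extend M a 0)).1
      rwa [mulVec_extend, dotProduct_selDesign_mulVec, penaltyDeriv_extend] at this
    refine dotProduct_eq _ _ fun a => le_antisymm ?_ ?_
    · rw [smul_dotProduct]; exact h1 a
    · have h2 := h1 (-a)
      rw [dotProduct_neg, dotProduct_neg] at h2
      rw [smul_dotProduct, smul_eq_mul]
      linarith
  have hcand : c = candidate R M s y := eq_candidate hG hact
  have hres : y - selDesign R M *ᵥ c = candidateResid R M s y := by rw [hcand, candidateResid]
  rw [hres] at hfo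
  have hdir : ∀ (i : Inactive R M) (a : ℝ),
      a * (candidateResid R M s y ⬝ᵥ R.X.col i) ≤ penalty R * (invWeight R i * |a|) := by
    intro i a
    have h1 := (hfo (Pi.single i.1 a + Function.extend M 0 0)).1
    rw [penaltyDeriv_single_add_extend, Matrix.mulVec_add, mulVec_extend, Matrix.mulVec_zero,
      add_zero, dotProduct_zero, zero_add, Matrix.mulVec_single] at h1
    simpa [dotProduct_smul] using h1
  -- A zero row means that the column is a combination of the selected columns, and moving along
  -- this linear relation leaves the fit unchanged.
  have hzero : ∀ (i : Inactive R M) (a : ℝ), a ≠ 0 →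
      (∀ x, ((inactDesign R M)ᵀ *ᵥ ((1 - proj R M) *ᵥ x)) i = 0) →
      0 < invWeight R i * |a| -
        a * ((inactDesign R M)ᵀ *ᵥ ((pinv R M)ᵀ *ᵥ signWeight R M s)) i := by
    intro i a ha hrow
    have hpt : (proj R M)ᵀ = proj R M := by
      rw [proj, Matrix.transpose_mul, transpose_pinv, pinv, Matrix.mul_assoc]
    have hcol : R.X.col i = selDesign R M *ᵥ (pinv R M *ᵥ R.X.col i) := by
      have h1 : (1 - proj R M) *ᵥ R.X.col i = 0 := by
        refine dotProduct_eq _ _ fun x => ?_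
        have h2 := hrow x
        have h3 : ((inactDesign R M)ᵀ *ᵥ ((1 - proj R M) *ᵥ x)) i =
          R.X.col i ⬝ᵥ ((1 - proj R M) *ᵥ x) := rfl
        rw [h3, Matrix.dotProduct_mulVec, ← Matrix.mulVec_transpose, Matrix.transpose_sub,
          Matrix.transpose_one, hpt] at h2
        rw [h2, zero_dotProduct]
      rw [Matrix.sub_mulVec, Matrix.one_mulVec, sub_eq_zero, proj, ← Matrix.mulVec_mulVec] at h1
      exact h1
    have h1 := (hfo (Pi.single i.1 a + Function.extend M (-(a • (pinv R M *ᵥ R.X.col i))) 0)).2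
    have hX : R.X *ᵥ (Pi.single i.1 a + Function.extend M (-(a • (pinv R M *ᵥ R.X.col i))) 0) =
        0 := by
      rw [Matrix.mulVec_add, mulVec_extend, Matrix.mulVec_neg, Matrix.mulVec_smul, ← hcol,
        Matrix.mulVec_single]
      simp
    have hne : (Pi.single i.1 a + Function.extend M (-(a • (pinv R M *ᵥ R.X.col i))) 0 :
        Fin R.J → ℝ) ≠ 0 := by
      intro h
      have h2 := congrFun h i.1
      rw [Pi.add_apply, Function.extend_apply' _ _ _ i.2] at h2
      simp [ha] at h2
    have h2 := h1 hX hne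
    rw [penaltyDeriv_single_add_extend, dotProduct_neg, dotProduct_smul, smul_eq_mul] at h2
    have h3 : signWeight R M s ⬝ᵥ (pinv R M *ᵥ R.X.col i) =
        ((inactDesign R M)ᵀ *ᵥ ((pinv R M)ᵀ *ᵥ signWeight R M s)) i := by
      rw [Matrix.dotProduct_mulVec, ← Matrix.mulVec_transpose, dotProduct_comm]; rfl
    rw [h3] at h2
    linarith
  rcases k with i | i | k
  · constructor
    · have h1 := gap_inl hL.ne' s y i
      have h2 := hdir i 1
      simp only [one_mul, abs_one, mul_one] at h2
      exact sub_nonneg.1 (nonneg_of_mul_nonneg_right (by rw [h1]; linarith) hL)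
    · intro hrow
      have h1 : ∀ x, ((inactDesign R M)ᵀ *ᵥ ((1 - proj R M) *ᵥ x)) i = 0 := by
        intro x
        have h2 := hrow x
        rw [constraintMatrix, Matrix.fromRows_mulVec] at h2
        simpa [Matrix.smul_mulVec, hL.ne', Matrix.mulVec_mulVec] using h2
      have h2 := hzero i 1 one_ne_zero h1
      rw [hrow, constraintBound]
      simpa using h2
  · constructor
    · have h1 := gap_inr_inl hL.ne' s y i
      have h2 := hdir i (-1)
      simp only [neg_mul, one_mul, abs_neg, abs_one, mul_one] at h2
      exact sub_nonneg.1 (nonneg_of_mul_nonneg_right (by rw [h1]; linarith) hL)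
    · intro hrow
      have h1 : ∀ x, ((inactDesign R M)ᵀ *ᵥ ((1 - proj R M) *ᵥ x)) i = 0 := by
        intro x
        have h2 := hrow x
        rw [constraintMatrix, Matrix.fromRows_mulVec, Matrix.fromRows_mulVec] at h2
        simpa [Matrix.smul_mulVec, Matrix.neg_mulVec, hL.ne', Matrix.mulVec_mulVec] using h2
      have h2 := hzero i (-1) (by norm_num) h1
      rw [hrow, constraintBound]
      simpa using h2
  · have h1 : 0 < (s k : ℝ) * candidate R M s y k := by
      rw [← hcand, hc, hs, lassoSigns]
      rw [sign_mul_self]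
      exact abs_pos.2 ((hsupp _).2 ⟨k, rfl⟩)
    rw [← gap_inr_inr] at h1
    exact ⟨(sub_pos.1 h1).le, fun _ => sub_pos.1 h1⟩

end

end

/-! ### Gaussian responses -/

section

variable {T m : ℕ}

/-- The law of a noise vector with independent centred normal entries. -/
def noiseLaw (T : ℕ) (v : ℝ≥0) : Measure (Fin T → ℝ) :=
  Measure.pi (fun _ : Fin T => gaussianReal 0 v)

instance (v : ℝ≥0) : IsProbabilityMeasure (noiseLaw T v) := by
  unfold noiseLaw; infer_instance

lemma iIndepFun_noise (v : ℝ≥0) :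
    iIndepFun (fun (t : Fin T) (e : Fin T → ℝ) => e t) (noiseLaw T v) :=
  iIndepFun_pi (X := fun _ => id) fun _ => aemeasurable_id

lemma map_eval_noise (v : ℝ≥0) (t : Fin T) :
    (noiseLaw T v).map (fun e => e t) = gaussianReal 0 v :=
  (measurePreserving_eval (fun _ : Fin T => gaussianReal 0 v) t).map_eq

lemma hasGaussianLaw_eval_noise (v : ℝ≥0) (t : Fin T) :
    HasGaussianLaw (fun e : Fin T → ℝ => e t) (noiseLaw T v) :=
  ⟨by rw [map_eval_noise]; infer_instance⟩

lemma hasGaussianLaw_noise (v : ℝ≥0) :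
    HasGaussianLaw (fun e : Fin T → ℝ => e) (noiseLaw T v) :=
  (iIndepFun_noise v).hasGaussianLaw fun t => hasGaussianLaw_eval_noise v t

lemma covariance_eval_noise (v : ℝ≥0) (t t' : Fin T) :
    cov[fun e : Fin T → ℝ => e t, fun e => e t'; noiseLaw T v] = if t = t' then (v : ℝ) else 0 := by
  by_cases h : t = t'
  · subst h
    rw [if_pos rfl, covariance_self (measurable_pi_apply t).aemeasurable]
    have h1 := variance_map (μ := noiseLaw T v) (X := id) (Y := fun e : Fin T → ℝ => e t)
      aemeasurable_id (measurable_pi_apply t).aemeasurable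
    rw [map_eval_noise, variance_id_gaussianReal] at h1
    exact h1.symm
  · rw [if_neg h]
    exact ((iIndepFun_noise v).indepFun h).covariance_eq_zero
      (hasGaussianLaw_eval_noise v t).memLp_two (hasGaussianLaw_eval_noise v t').memLp_two

lemma covariance_dotProduct_noise (v : ℝ≥0) (a b : Fin T → ℝ) :
    cov[fun e => a ⬝ᵥ e, fun e => b ⬝ᵥ e; noiseLaw T v] = v * (a ⬝ᵥ b) := by
  have h : ∀ (a : Fin T → ℝ) t, MemLp (fun e : Fin T → ℝ => a t * e t) 2 (noiseLaw T v) :=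
    fun a t => (hasGaussianLaw_eval_noise v t).memLp_two.const_mul _
  simp only [dotProduct]
  rw [covariance_fun_sum_fun_sum (h a) (h b), Finset.mul_sum]
  refine Finset.sum_congr rfl fun t _ => ?_
  rw [Finset.sum_eq_single t]
  · rw [covariance_const_mul_left, covariance_const_mul_right, covariance_eval_noise, if_pos rfl]
    ring
  · intro t' _ ht
    rw [covariance_const_mul_left, covariance_const_mul_right, covariance_eval_noise,
      if_neg ht.symm]
    ring
  · simp

lemma map_dotProduct_noise (v : ℝ≥0) (a : Fin T → ℝ) :
    (noiseLaw T v).map (fun e => a ⬝ᵥ e) = gaussianReal 0 (v * (a ⬝ᵥ a)).toNNReal := by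
  have hg : HasGaussianLaw (fun e => a ⬝ᵥ e) (noiseLaw T v) := by
    have := (hasGaussianLaw_noise (T := T) v).map_fun
      (LinearMap.toContinuousLinearMap (dotProductBilin ℝ ℝ a))
    exact this
  have hm : Measurable fun e : Fin T → ℝ => a ⬝ᵥ e := by
    unfold dotProduct; fun_prop
  have hmean : ∫ e, a ⬝ᵥ e ∂(noiseLaw T v) = 0 := by
    simp only [dotProduct]
    rw [integral_finsetSum _ fun t _ => (hasGaussianLaw_eval_noise v t).integrable.const_mul _]
    refine Finset.sum_eq_zero fun t _ => ?_
    rw [integral_const_mul]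
    have h1 := integral_map (μ := noiseLaw T v) (φ := fun e : Fin T → ℝ => e t)
      (measurable_pi_apply t).aemeasurable (f := fun x : ℝ => x) (by fun_prop)
    rw [map_eval_noise, integral_id_gaussianReal] at h1
    rw [← h1, mul_zero]
  rw [hg.map_eq_gaussianReal, hmean, ← covariance_self hm.aemeasurable,
    covariance_dotProduct_noise]

/-- Orthogonal directions of the noise are independent: `a · e` is independent of the component of
`e` orthogonal to `a`. -/
lemma indepFun_resid_noise (v : ℝ≥0) {a : Fin T → ℝ} (ha : a ⬝ᵥ a ≠ 0) :
    IndepFun (fun e : Fin T → ℝ => e - (a ⬝ᵥ e) • ((a ⬝ᵥ a)⁻¹ • a)) (fun e => a ⬝ᵥ e)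
      (noiseLaw T v) := by
  have hm : ∀ a : Fin T → ℝ, Continuous fun e : Fin T → ℝ => a ⬝ᵥ e := fun a => by
    unfold dotProduct; fun_prop
  let L : (Fin T → ℝ) →ₗ[ℝ] (Fin T → ℝ) × (Unit → ℝ) :=
    { toFun := fun e => (fun t => e t - (a ⬝ᵥ e) * ((a ⬝ᵥ a)⁻¹ * a t), fun _ => a ⬝ᵥ e)
      map_add' := fun e e' => by
        ext <;> simp [dotProduct_add]; ring
      map_smul' := fun c e => by
        ext <;> simp; ring }
  have hg : HasGaussianLaw (fun e : Fin T → ℝ =>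
      ((fun t => e t - (a ⬝ᵥ e) * ((a ⬝ᵥ a)⁻¹ * a t) : Fin T → ℝ), (fun _ => a ⬝ᵥ e : Unit → ℝ)))
      (noiseLaw T v) :=
    (hasGaussianLaw_noise (T := T) v).map_fun (LinearMap.toContinuousLinearMap L)
  have hind := hg.indepFun_of_covariance_eval (X := fun t e => e t -
      (a ⬝ᵥ e) * ((a ⬝ᵥ a)⁻¹ * a t)) (Y := fun (_ : Unit) e => a ⬝ᵥ e) fun t _ => by
    have h1 : (fun e : Fin T → ℝ => e t - (a ⬝ᵥ e) * ((a ⬝ᵥ a)⁻¹ * a t)) =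
        fun e => (Pi.single t 1 - ((a ⬝ᵥ a)⁻¹ * a t) • a) ⬝ᵥ e := by
      funext e
      rw [sub_dotProduct, single_one_dotProduct, smul_dotProduct, smul_eq_mul]
      ring
    rw [h1, covariance_dotProduct_noise, sub_dotProduct, single_one_dotProduct, smul_dotProduct,
      smul_eq_mul]
    field_simp
    ring
  exact hind.comp (φ := fun x => x) (ψ := fun x : Unit → ℝ => x ()) measurable_id
    (measurable_pi_apply _)

lemma responseLaw_eq (R : Regression T) (v : ℝ≥0) :
    responseLaw R v = (noiseLaw T v).map (fun e => R.X *ᵥ R.coef + e) := rfl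

instance (R : Regression T) (v : ℝ≥0) : IsProbabilityMeasure (responseLaw R v) := by
  rw [responseLaw_eq]
  exact Measure.isProbabilityMeasure_map (by fun_prop)

lemma measurable_dotProduct (a : Fin T → ℝ) : Measurable fun y : Fin T → ℝ => a ⬝ᵥ y := by
  unfold dotProduct; fun_prop

lemma responseLaw_hyperplane (R : Regression T) {v : ℝ≥0} (hv : v ≠ 0) {a : Fin T → ℝ}
    (ha : a ≠ 0) (c : ℝ) : responseLaw R v {y | a ⬝ᵥ y = c} = 0 := by
  have hm : MeasurableSet {y : Fin T → ℝ | a ⬝ᵥ y = c} :=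
    measurable_dotProduct a (measurableSet_singleton c)
  have hpos : 0 < (v : ℝ) * (a ⬝ᵥ a) :=
    mul_pos (by positivity) (lt_of_le_of_ne (Finset.sum_nonneg fun t _ => mul_self_nonneg _)
      (Ne.symm fun h => ha (dotProduct_self_eq_zero.1 h)))
  have := nullSingletonClass_gaussianReal (μ := 0) (Real.toNNReal_pos.2 hpos).ne'
  rw [responseLaw_eq, Measure.map_apply (by fun_prop) hm]
  have h1 : (fun e => R.X *ᵥ R.coef + e) ⁻¹' {y : Fin T → ℝ | a ⬝ᵥ y = c} =
      (fun e => a ⬝ᵥ e) ⁻¹' {c - a ⬝ᵥ (R.X *ᵥ R.coef)} := by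
    ext e
    simp only [Set.mem_preimage, Set.mem_ofPred_eq, Set.mem_singleton_iff, dotProduct_add]
    constructor <;> intro h <;> linarith
  rw [h1, ← Measure.map_apply (measurable_dotProduct a) (measurableSet_singleton _),
    map_dotProduct_noise, measure_singleton]

/-- The statistic `ηᵀ Y`, standardized with the true standard deviation of the noise. -/
def standardized (R : Regression T) (M : Fin m ↪ Fin R.J) (j : Fin m) (v : ℝ≥0)
    (y : Fin T → ℝ) : ℝ :=
  (eta R M j ⬝ᵥ y) / (etaNorm R M j * √(v : ℝ))

lemma measurable_resid (R : Regression T) (M : Fin m ↪ Fin R.J) (j : Fin m) :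
    Measurable (resid R M j) :=
  measurable_id.sub ((measurable_dotProduct _).smul_const _)

lemma measurable_standardized (R : Regression T) (M : Fin m ↪ Fin R.J) (j : Fin m) (v : ℝ≥0) :
    Measurable (standardized R M j v) :=
  (measurable_dotProduct _).div_const _

/-- Under the null hypothesis, the standardized statistic is standard normal and independent of
`z`. -/
lemma map_resid_standardized (R : Regression T) (M : Fin m ↪ Fin R.J) (j : Fin m) {v : ℝ≥0}
    (hv : v ≠ 0) (heta : eta R M j ⬝ᵥ eta R M j ≠ 0)
    (hnull : eta R M j ⬝ᵥ (R.X *ᵥ R.coef) = 0) :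
    (responseLaw R v).map (fun y => (resid R M j y, standardized R M j v y)) =
      ((responseLaw R v).map (resid R M j)).prod (gaussianReal 0 1) := by
  set a := eta R M j with ha
  have hs : Measurable fun e : Fin T → ℝ => R.X *ᵥ R.coef + e := by fun_prop
  have hind : IndepFun (resid R M j) (standardized R M j v) (responseLaw R v) := by
    rw [responseLaw_eq]
    rw [indepFun_iff_map_prod_eq_prod_map_map (measurable_resid R M j).aemeasurable
      (measurable_standardized R M j v).aemeasurable,
      Measure.map_map ((measurable_resid R M j).prodMk (measurable_standardized R M j v)) hs,
      Measure.map_map (measurable_resid R M j) hs,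
      Measure.map_map (measurable_standardized R M j v) hs]
    refine IndepFun.map_prod_eq_prod_map_map
      ((measurable_resid R M j).comp hs).aemeasurable
      ((measurable_standardized R M j v).comp hs).aemeasurable ?_
    have h := (indepFun_resid_noise v heta).comp
      (φ := fun w => R.X *ᵥ R.coef + w) (ψ := fun x => x / (etaNorm R M j * √(v : ℝ)))
      (by fun_prop) (by fun_prop)
    convert h using 1
    · funext e
      simp only [Function.comp, resid, dotProduct_add, hnull, zero_add, xi, ← ha]
      abel
    · funext e
      simp only [Function.comp, standardized, dotProduct_add, hnull, zero_add, ← ha]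
  have hlaw : (responseLaw R v).map (standardized R M j v) = gaussianReal 0 1 := by
    have hv' : (0 : ℝ) < v := by positivity
    have hpos : 0 < a ⬝ᵥ a := lt_of_le_of_ne
      (Finset.sum_nonneg fun t _ => mul_self_nonneg _) heta.symm
    have h1 : standardized R M j v ∘ (fun e => R.X *ᵥ R.coef + e) =
        (fun x => x / (etaNorm R M j * √(v : ℝ))) ∘ fun e => a ⬝ᵥ e := by
      funext e
      simp only [Function.comp, standardized, dotProduct_add, hnull, zero_add, ← ha]
    rw [responseLaw_eq, Measure.map_map (measurable_standardized R M j v) hs, h1,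
      ← Measure.map_map (by fun_prop) (measurable_dotProduct a), map_dotProduct_noise,
      gaussianReal_map_div_const, zero_div]
    congr 1
    rw [← NNReal.coe_inj]
    rw [NNReal.coe_div, Real.coe_toNNReal _ (mul_pos hv' hpos).le]
    simp only [NNReal.coe_mk, NNReal.coe_one]
    rw [etaNorm, mul_pow, Real.sq_sqrt hpos.le, Real.sq_sqrt hv'.le]
    field_simp
  rw [hind.map_prod_eq_prod_map_map (measurable_resid R M j).aemeasurable
    (measurable_standardized R M j v).aemeasurable, hlaw]

end

/-! ### The conditional law of the test statistic given the selection -/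

section

variable {T m : ℕ}

lemma iSup_iSup_lt_iff_of_finite {ι : Type*} [Finite ι] {p : ι → Prop} {f : ι → EReal} {a : EReal}
    (ha : ⊥ < a) : (⨆ (i) (_ : p i), f i) < a ↔ ∀ i, p i → f i < a := by
  have := Fintype.ofFinite ι
  rw [← Finset.sup_univ_eq_iSup, Finset.sup_lt_iff ha]
  refine forall_congr' fun i => ?_
  by_cases hi : p i <;> simp [hi, ha]

lemma lt_iInf_iInf_iff_of_finite {ι : Type*} [Finite ι] {p : ι → Prop} {f : ι → EReal} {a : EReal}
    (ha : a < ⊤) : a < (⨅ (i) (_ : p i), f i) ↔ ∀ i, p i → a < f i := by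
  have := Fintype.ofFinite ι
  rw [← Finset.inf_univ_eq_iInf, Finset.lt_inf_iff ha]
  refine forall_congr' fun i => ?_
  by_cases hi : p i <;> simp [hi, ha]

/-- The lower end of the truncation interval of `standardized`. -/
def lowerEnd (R : Regression T) (M : Fin m ↪ Fin R.J) (j : Fin m) (v : ℝ≥0)
    (s : Fin m → SignType) (z : Fin T → ℝ) : EReal :=
  Vminus R M s j z / ((etaNorm R M j * √(v : ℝ) : ℝ) : EReal)

/-- The upper end of the truncation interval of `standardized`. -/
def upperEnd (R : Regression T) (M : Fin m ↪ Fin R.J) (j : Fin m) (v : ℝ≥0)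
    (s : Fin m → SignType) (z : Fin T → ℝ) : EReal :=
  Vplus R M s j z / ((etaNorm R M j * √(v : ℝ) : ℝ) : EReal)

/-- The values of `z` that satisfy the constraints in which the statistic `ηᵀ Y` does not enter;
empty if `s` is not one of the signs under consideration. -/
def nuisanceSet (R : Regression T) (M : Fin m ↪ Fin R.J) (S : Set (Fin m → SignType)) (j : Fin m)
    (s : Fin m → SignType) : Set (Fin T → ℝ) :=
  {z | s ∈ S ∧ ∀ k, (constraintMatrix R M s *ᵥ xi R M j) k = 0 →
    (constraintMatrix R M s *ᵥ z) k < constraintBound R M s k}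

variable {R : Regression T} {M : Fin m ↪ Fin R.J} {j : Fin m}

lemma eq_resid_add (y : Fin T → ℝ) : y = resid R M j y + (eta R M j ⬝ᵥ y) • xi R M j := by
  rw [resid]; abel

/-- Intersecting the polyhedron `A y < b` with the line through `z` in direction `ξ` yields the
interval between `V⁻(z)` and `V⁺(z)`, provided that `z` satisfies the constraints parallel to this
line. -/
lemma mem_cell_iff {v : ℝ≥0} (hk : 0 < etaNorm R M j * √(v : ℝ)) {S : Set (Fin m → SignType)}
    (s : Fin m → SignType) (y : Fin T → ℝ) :
    y ∈ cell (resid R M j) (standardized R M j v) (lowerEnd R M j v s) (upperEnd R M j v s)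
        (nuisanceSet R M S j s) ↔
      s ∈ S ∧ ∀ k, (constraintMatrix R M s *ᵥ y) k < constraintBound R M s k := by
  set t := eta R M j ⬝ᵥ y
  set z := resid R M j y
  set κ := etaNorm R M j * √(v : ℝ)
  have hκ' : (0 : EReal) < (κ : EReal) := by exact_mod_cast hk
  have hA : ∀ k, (constraintMatrix R M s *ᵥ y) k = (constraintMatrix R M s *ᵥ z) k +
      t * (constraintMatrix R M s *ᵥ xi R M j) k := by
    intro k
    conv_lhs => rw [eq_resid_add (R := R) (M := M) (j := j) y]
    rw [Matrix.mulVec_add, Matrix.mulVec_smul]; rfl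
  have hU : ((standardized R M j v y : ℝ) : EReal) * (κ : EReal) = (t : EReal) := by
    rw [← EReal.coe_mul, standardized, div_mul_cancel₀ _ hk.ne']
  have h1 : lowerEnd R M j v s z < (standardized R M j v y : EReal) ↔
      ∀ k, (constraintMatrix R M s *ᵥ xi R M j) k < 0 →
        (constraintBound R M s k - (constraintMatrix R M s *ᵥ z) k) /
          (constraintMatrix R M s *ᵥ xi R M j) k < t := by
    rw [lowerEnd, EReal.div_lt_iff hκ' (EReal.coe_ne_top _), hU, Vminus,
      iSup_iSup_lt_iff_of_finite (EReal.bot_lt_coe _)]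
    simp only [EReal.coe_lt_coe_iff]
  have h2 : (standardized R M j v y : EReal) < upperEnd R M j v s z ↔
      ∀ k, 0 < (constraintMatrix R M s *ᵥ xi R M j) k →
        t < (constraintBound R M s k - (constraintMatrix R M s *ᵥ z) k) /
          (constraintMatrix R M s *ᵥ xi R M j) k := by
    rw [upperEnd, EReal.lt_div_iff hκ' (EReal.coe_ne_top _), hU, Vplus,
      lt_iInf_iInf_iff_of_finite (EReal.coe_lt_top _)]
    simp only [EReal.coe_lt_coe_iff]
  rw [cell, Set.mem_ofPred_eq, nuisanceSet, Set.mem_ofPred_eq, h1, h2]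
  constructor
  · rintro ⟨⟨hs, h0⟩, hn, hp⟩
    refine ⟨hs, fun k => ?_⟩
    rw [hA]
    rcases lt_trichotomy ((constraintMatrix R M s *ᵥ xi R M j) k) 0 with h | h | h
    · have := (div_lt_iff_of_neg h).1 (hn k h)
      linarith
    · rw [h, mul_zero, add_zero]; exact h0 k h
    · have := (lt_div_iff₀ h).1 (hp k h)
      linarith
  · rintro ⟨hs, h⟩
    refine ⟨⟨hs, fun k hk => ?_⟩, fun k hk => ?_, fun k hk => ?_⟩
    · have := h k
      rwa [hA, hk, mul_zero, add_zero] at this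
    · rw [div_lt_iff_of_neg hk]
      have := h k
      rw [hA] at this
      linarith
    · rw [lt_div_iff₀ hk]
      have := h k
      rw [hA] at this
      linarith

lemma measurable_mulVec_apply {ι : Type*} (A : Matrix ι (Fin T) ℝ) (k : ι) :
    Measurable fun z : Fin T → ℝ => (A *ᵥ z) k :=
  measurable_dotProduct (A k)

lemma measurable_Vminus (R : Regression T) (M : Fin m ↪ Fin R.J) (s : Fin m → SignType)
    (j : Fin m) : Measurable (Vminus R M s j) := by
  unfold Vminus
  refine Measurable.iSup fun k => Measurable.iSup fun _ => Measurable.coe_real_ereal ?_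
  exact ((measurable_mulVec_apply _ k).const_sub _).div_const _

lemma measurable_Vplus (R : Regression T) (M : Fin m ↪ Fin R.J) (s : Fin m → SignType)
    (j : Fin m) : Measurable (Vplus R M s j) := by
  unfold Vplus
  refine Measurable.iInf fun k => Measurable.iInf fun _ => Measurable.coe_real_ereal ?_
  exact ((measurable_mulVec_apply _ k).const_sub _).div_const _

lemma measurableSet_nuisanceSet (S : Set (Fin m → SignType)) (s : Fin m → SignType) :
    MeasurableSet (nuisanceSet R M S j s) := by
  refine (MeasurableSet.const _).inter ?_
  have h : {z : Fin T → ℝ | ∀ k, (constraintMatrix R M s *ᵥ xi R M j) k = 0 →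
      (constraintMatrix R M s *ᵥ z) k < constraintBound R M s k} =
      ⋂ (k) (_ : (constraintMatrix R M s *ᵥ xi R M j) k = 0),
        {z | (constraintMatrix R M s *ᵥ z) k < constraintBound R M s k} := by
    ext z; simp
  have h2 : MeasurableSet (⋂ (k) (_ : (constraintMatrix R M s *ᵥ xi R M j) k = 0),
      {z | (constraintMatrix R M s *ᵥ z) k < constraintBound R M s k}) :=
    MeasurableSet.iInter fun k => MeasurableSet.iInter fun _ =>
      measurableSet_lt (measurable_mulVec_apply _ k) measurable_const
  rw [← h] at h2
  exact h2

lemma measurable_ereal_div_coe {α : Type*} [MeasurableSpace α] {f : α → EReal} {g : α → ℝ}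
    (hf : Measurable f) (hg : Measurable g) : Measurable fun x => f x / (g x : EReal) := by
  have h : ∀ x, f x / (g x : EReal) = f x * ((g x)⁻¹ : ℝ) := fun x => by
    rw [EReal.div_eq_inv_mul, mul_comm, EReal.coe_inv]
  simp only [h]
  exact hf.mul hg.inv.coe_real_ereal

lemma eta_dotProduct (R : Regression T) (M : Fin m ↪ Fin R.J) (j : Fin m) (y : Fin T → ℝ) :
    eta R M j ⬝ᵥ y = (pinv R M *ᵥ y) j := by
  rw [eta, Matrix.mulVec_single_one]
  rfl

lemma eta_dotProduct_self_ne_zero (hG : IsUnit ((selDesign R M)ᵀ * selDesign R M).det) :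
    eta R M j ⬝ᵥ eta R M j ≠ 0 := by
  intro h
  have h0 := dotProduct_self_eq_zero.1 h
  have h1 := eta_dotProduct R M j (selDesign R M *ᵥ Pi.single j 1)
  rw [Matrix.mulVec_mulVec, pinv_mul_selDesign hG, h0, zero_dotProduct] at h1
  simp at h1

lemma etaNorm_pos (hG : IsUnit ((selDesign R M)ᵀ * selDesign R M).det) : 0 < etaNorm R M j :=
  Real.sqrt_pos.2 (lt_of_le_of_ne (Finset.sum_nonneg fun _ _ => mul_self_nonneg _)
    (eta_dotProduct_self_ne_zero hG).symm)

/-- The debiased estimator is the least squares estimator in the selected model. -/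
lemma debiased_eq (hG : IsUnit ((selDesign R M)ᵀ * selDesign R M).det) (y : Fin T → ℝ) :
    debiased R M y = pinv R M *ᵥ y := by
  rw [debiased, Matrix.mulVec_sub, Matrix.mulVec_mulVec, pinv_mul_selDesign hG, Matrix.one_mulVec]
  abel

/-- The polyhedral lemma: up to null sets, the selection event is the disjoint union over the sign
vectors of polyhedra, and intersecting a polyhedron with a line in direction `ξ` confines the
statistic to an interval. -/
theorem isTruncationModel (hT : 0 < T) (hlam : 0 < R.lam)
    (hG : IsUnit ((selDesign R M)ᵀ * selDesign R M).det) {v : ℝ≥0} (hv : v ≠ 0)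
    (hnull : selCoef R M j = 0) (S : Set (Fin m → SignType)) :
    IsTruncationModel (responseLaw R v) (selectionEvent R M S) (resid R M j)
      (standardized R M j v) (lassoSigns R M) (lowerEnd R M j v) (upperEnd R M j v)
      (nuisanceSet R M S j) := by
  have hk : 0 < etaNorm R M j * √(v : ℝ) :=
    mul_pos (etaNorm_pos hG) (Real.sqrt_pos.2 (by positivity))
  have hlo : ∀ s, Measurable (lowerEnd R M j v s) := fun s =>
    measurable_ereal_div_coe (measurable_Vminus R M s j) measurable_const
  have hhi : ∀ s, Measurable (upperEnd R M j v s) := fun s =>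
    measurable_ereal_div_coe (measurable_Vplus R M s j) measurable_const
  set C : (Fin m → SignType) → Set (Fin T → ℝ) := fun s =>
    cell (resid R M j) (standardized R M j v) (lowerEnd R M j v s) (upperEnd R M j v s)
      (nuisanceSet R M S j s) with hC
  have hCm : ∀ s, MeasurableSet (C s) := fun s =>
    measurableSet_cell (measurable_resid R M j) (measurable_standardized R M j v) (hlo s) (hhi s)
      (measurableSet_nuisanceSet S s)
  have hsel : ∀ s, ∀ y ∈ C s, y ∈ selectionEvent R M S ∧ lassoSigns R M y = s := by
    intro s y hy
    obtain ⟨hs, h⟩ := (mem_cell_iff hk s y).1 hy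
    exact mem_selectionEvent_of_constraints hT hlam hG hs h
  have hdisj : Pairwise (Function.onFun Disjoint C) := fun s s' hss =>
    Set.disjoint_left.2 fun y hy hy' => hss ((hsel s y hy).2.symm.trans (hsel s' y hy').2)
  refine ⟨measurable_resid R M j, measurable_standardized R M j v,
    map_resid_standardized R M j hv (eta_dotProduct_self_ne_zero hG)
      ((eta_dotProduct R M j _).trans hnull), hlo, hhi, measurableSet_nuisanceSet S, ?_, ?_⟩
  · rw [← Measure.restrict_iUnion hdisj hCm]
    refine Measure.restrict_congr_set (ae_eq_set.2 ⟨?_, ?_⟩)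
    · -- What is left of the event lies on finitely many hyperplanes.
      refine measure_mono_null (t := ⋃ (s : Fin m → SignType) (k : Constraint R M)
        (_ : constraintMatrix R M s k ≠ 0),
          {y | constraintMatrix R M s k ⬝ᵥ y = constraintBound R M s k}) ?_ ?_
      · rintro y ⟨hy, hyC⟩
        by_contra hcon
        simp only [Set.mem_iUnion, not_exists] at hcon
        refine hyC (Set.mem_iUnion.2 ⟨lassoSigns R M y, (mem_cell_iff hk _ y).2
          ⟨hy.2.2, fun k => ?_⟩⟩)
        obtain ⟨h1, h2⟩ := constraints_of_mem_selectionEvent hT hlam hG hy k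
        by_cases hrow : constraintMatrix R M (lassoSigns R M y) k = 0
        · refine h2 fun x => ?_
          rw [Matrix.mulVec, hrow, zero_dotProduct]
        · exact lt_of_le_of_ne h1 (hcon (lassoSigns R M y) k hrow)
      · refine measure_iUnion_null fun s => measure_iUnion_null fun k =>
          measure_iUnion_null fun hrow => ?_
        exact responseLaw_hyperplane R hv hrow _
    · rw [Set.sdiff_eq_empty.2, measure_empty]
      exact Set.iUnion_subset fun s y hy => (hsel s y hy).1
  · intro s
    filter_upwards [ae_restrict_mem (hCm s)] with y hy
    exact (hsel s y hy).2

end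

/-! ### Limit theorems -/

section

variable {T m : ℕ} {R : Regression T} {M : Fin m ↪ Fin R.J} {j : Fin m}

lemma studentized_eq (hG : IsUnit ((selDesign R M)ᵀ * selDesign R M).det) {v : ℝ≥0} (hv : v ≠ 0)
    (vhat : (Fin T → ℝ) → ℝ) (y : Fin T → ℝ) :
    studentized R M j vhat y = √(v : ℝ) / √(vhat y) * standardized R M j v y := by
  have h1 : √(v : ℝ) ≠ 0 := (Real.sqrt_pos.2 (by positivity)).ne'
  rw [studentized, debiased_eq hG, ← eta_dotProduct, scale, standardized]
  field_simp

/-- Estimating the standard deviation rescales the truncation set. -/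
lemma mem_truncationSet_iff (hG : IsUnit ((selDesign R M)ᵀ * selDesign R M).det) {v : ℝ≥0}
    (hv : v ≠ 0) {vhat : (Fin T → ℝ) → ℝ} {y : Fin T → ℝ} (hy : 0 < vhat y) (t : ℝ) :
    t ∈ truncationSet R M j vhat y ↔ t / (√(v : ℝ) / √(vhat y)) ∈
      realIcc (lowerEnd R M j v (lassoSigns R M y) (resid R M j y))
        (upperEnd R M j v (lassoSigns R M y) (resid R M j y)) := by
  have h1 : 0 < √(v : ℝ) := Real.sqrt_pos.2 (by positivity)
  have h2 : 0 < √(vhat y) := Real.sqrt_pos.2 hy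
  have h3 : 0 < etaNorm R M j := etaNorm_pos hG
  have hs : (0 : EReal) < (scale R M j vhat y : EReal) := by exact_mod_cast mul_pos h3 h2
  have hk : (0 : EReal) < ((etaNorm R M j * √(v : ℝ) : ℝ) : EReal) := by
    exact_mod_cast mul_pos h3 h1
  have ht : (scale R M j vhat y : EReal) * (t : EReal) =
      ((etaNorm R M j * √(v : ℝ) : ℝ) : EReal) * ((t / (√(v : ℝ) / √(vhat y)) : ℝ) : EReal) := by
    rw [← EReal.coe_mul, ← EReal.coe_mul, scale]
    congr 1
    field_simp
  rw [truncationSet, realIcc, Set.mem_ofPred_eq, Set.mem_ofPred_eq, lowerEnd, upperEnd,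
    EReal.div_le_iff_le_mul hs (EReal.coe_ne_top _), EReal.div_le_iff_le_mul hk
    (EReal.coe_ne_top _), EReal.le_div_iff_mul_le hs (EReal.coe_ne_top _),
    EReal.le_div_iff_mul_le hk (EReal.coe_ne_top _), mul_comm (t : EReal), ht,
    mul_comm ((t / (√(v : ℝ) / √(vhat y)) : ℝ) : EReal)]

lemma truncationSet_eq_realIcc (vhat : (Fin T → ℝ) → ℝ) (y : Fin T → ℝ) :
    truncationSet R M j vhat y =
      realIcc (Vminus R M (lassoSigns R M y) j (resid R M j y) / (scale R M j vhat y : EReal))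
        (Vplus R M (lassoSigns R M y) j (resid R M j y) / (scale R M j vhat y : EReal)) := rfl

lemma measurable_scale {vhat : (Fin T → ℝ) → ℝ} (hvhat : Measurable vhat) :
    Measurable (scale R M j vhat) :=
  (Real.continuous_sqrt.measurable.comp hvhat).const_mul _

lemma integrable_studentized_sub (hT : 0 < T) (hlam : 0 < R.lam)
    (hG : IsUnit ((selDesign R M)ᵀ * selDesign R M).det) {v : ℝ≥0} (hv : v ≠ 0)
    (hnull : selCoef R M j = 0) {S : Set (Fin m → SignType)}
    (hE : responseLaw R v (selectionEvent R M S) ≠ 0) {vhat : (Fin T → ℝ) → ℝ}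
    (hvhat : Measurable vhat) {f : ℝ → ℝ} (hfm : Measurable f) (hf : ∀ x, |f x| ≤ 1) :
    Integrable (fun y => f (studentized R M j vhat y) -
        ∫ x, f x ∂(truncNormal (truncationSet R M j vhat y)))
      (ProbabilityTheory.cond (responseLaw R v) (selectionEvent R M S)) := by
  have H := isTruncationModel hT hlam hG hv hnull S
  have := cond_isProbabilityMeasure hE
  have hsm : Measurable fun y => studentized R M j vhat y := by
    have h : (fun y => studentized R M j vhat y) =
        fun y => (eta R M j ⬝ᵥ y) / scale R M j vhat y := by
      funext y
      rw [studentized, debiased_eq hG, ← eta_dotProduct]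
    rw [h]
    exact (measurable_dotProduct _).div (measurable_scale hvhat)
  refine Integrable.of_bound (AEMeasurable.aestronglyMeasurable ?_) 2
    (Eventually.of_forall fun y => abs_sub_integral_truncNormal_le _ hf _)
  refine (hfm.comp hsm).aemeasurable.sub ?_
  refine H.aemeasurable_lab (K := fun s y => ∫ x, f x ∂(truncNormal
    (realIcc (Vminus R M s j (resid R M j y) / (scale R M j vhat y : EReal))
      (Vplus R M s j (resid R M j y) / (scale R M j vhat y : EReal))))) fun s => ?_
  exact measurable_integral_truncNormal (g := fun p => f p.2)
    (measurable_ereal_div_coe ((measurable_Vminus R M s j).comp (measurable_resid R M j))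
      (measurable_scale hvhat))
    (measurable_ereal_div_coe ((measurable_Vplus R M s j).comp (measurable_resid R M j))
      (measurable_scale hvhat)) (hfm.comp measurable_snd)

/-- A property of all numbers near `1` holds for the ratio of the true to the estimated standard
deviation as soon as the variance estimate is close to the true variance. -/
lemma exists_pos_of_eventually_nhds_one {v : ℝ≥0} (hv : v ≠ 0) {p : ℝ → Prop}
    (hp : ∀ᶠ r in 𝓝 1, p r) :
    ∃ ε > 0, ∀ x : ℝ, |x - v| < ε → 0 < x ∧ p (√(v : ℝ) / √x) := by
  have hv' : (0 : ℝ) < v := by positivity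
  have hs : √(v : ℝ) ≠ 0 := (Real.sqrt_pos.2 hv').ne'
  have hc : Tendsto (fun x : ℝ => √(v : ℝ) / √x) (𝓝 (v : ℝ)) (𝓝 1) := by
    have h : ContinuousAt (fun x : ℝ => √(v : ℝ) / √x) (v : ℝ) :=
      continuousAt_const.div Real.continuous_sqrt.continuousAt hs
    have h2 := h.tendsto
    rwa [div_self hs] at h2
  obtain ⟨ε, hε, h⟩ := Metric.eventually_nhds_iff.1 ((eventually_gt_nhds hv').and (hc.eventually hp))
  exact ⟨ε, hε, fun x hx => h (by rwa [Real.dist_eq])⟩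

lemma eventually_isUnit_det {R : ∀ T : ℕ, Regression T} {M : ∀ T : ℕ, Fin m ↪ Fin (R T).J}
    (hgram : ∃ G : Matrix (Fin m) (Fin m) ℝ, G.rank = m ∧
      Tendsto (fun T : ℕ => (1 / (T : ℝ)) • ((selDesign (R T) (M T))ᵀ *
        selDesign (R T) (M T))) atTop (𝓝 G)) :
    ∀ᶠ T in atTop, IsUnit ((selDesign (R T) (M T))ᵀ * selDesign (R T) (M T)).det := by
  obtain ⟨G, hr, hG⟩ := hgram
  have hdet : G.det ≠ 0 := by
    have h : LinearMap.range G.mulVecLin = ⊤ :=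
      Submodule.eq_top_of_finrank_eq (by simpa [Matrix.rank] using hr)
    have h2 : Function.Surjective G.mulVec := fun y => LinearMap.range_eq_top.1 h y
    exact ((Matrix.isUnit_iff_isUnit_det G).1 (Matrix.mulVec_surjective_iff_isUnit.1 h2)).ne_zero
  have hc : Continuous fun A : Matrix (Fin m) (Fin m) ℝ => A.det := continuous_id.matrix_det
  filter_upwards [((hc.tendsto G).comp hG).eventually_ne hdet] with T hT
  simp only [Function.comp, Matrix.det_smul] at hT
  exact isUnit_iff_ne_zero.2 (right_ne_zero_of_mul hT)

section Limits

variable {R : ∀ T : ℕ, Regression T} {M : ∀ T : ℕ, Fin m ↪ Fin (R T).J}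
  {S : Set (Fin m → SignType)} {v : ℝ≥0} {vhat : ∀ T : ℕ, (Fin T → ℝ) → ℝ}

lemma measurableSet_le_abs_sub {vhat : (Fin T → ℝ) → ℝ} (hvhat : Measurable vhat) (ε c : ℝ) :
    MeasurableSet {y | ε ≤ |vhat y - c|} :=
  measurableSet_le measurable_const (continuous_abs.measurable.comp (hvhat.sub_const c))

/-- Weak convergence of the studentized statistic. -/
theorem convergesWeaklyGiven_studentized (hv : v ≠ 0) (hvhat : ∀ T, Measurable (vhat T))
    (hgood : ∀ᶠ T in atTop, 0 < T ∧ 0 < (R T).lam ∧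
      IsUnit ((selDesign (R T) (M T))ᵀ * selDesign (R T) (M T)).det ∧
      selCoef (R T) (M T) j = 0 ∧ responseLaw (R T) v (selectionEvent (R T) (M T) S) ≠ 0)
    (hcons : ConsistentGiven (fun T => responseLaw (R T) v)
      (fun T => selectionEvent (R T) (M T) S) vhat (v : ℝ)) :
    ConvergesWeaklyGiven (fun T => responseLaw (R T) v) (fun T => selectionEvent (R T) (M T) S)
      (fun T => resid (R T) (M T) j) (fun T => studentized (R T) (M T) j (vhat T))
      (fun T y => truncNormal (truncationSet (R T) (M T) j (vhat T) y)) := by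
  intro δ hδ
  obtain ⟨ε, hε, hr⟩ := exists_pos_of_eventually_nhds_one hv
    (eventually_abs_sub_scaled_le (show (0 : ℝ) < δ / 4 by positivity))
  filter_upwards [hgood, (hcons ε hε).eventually_lt_const (show (0 : ℝ) < δ / 8 by positivity)]
    with T ⟨hT, hlam, hG, hnull, hE⟩ hN f hf hfl
  have hfm := measurable_of_lipschitz hfl
  have H := isTruncationModel hT hlam hG hv hnull S
  have hg := integrable_studentized_sub hT hlam hG hv hnull hE (hvhat T) hfm hf
  refine ⟨hg, ?_⟩
  refine (H.integral_abs_condExp_le hE hfm hf hg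
    (fun y => abs_sub_integral_truncNormal_le _ hf _)
    (measurableSet_le_abs_sub (hvhat T) ε v) (show 0 ≤ δ / 4 by positivity) ?_).trans ?_
  · filter_upwards [H.ae_mem_and_ne_zero] with y ⟨hmem, hne⟩ hyN
    obtain ⟨hpos, h⟩ := hr (vhat T y) (not_le.1 hyN)
    have h2 := h _ _ _ _ hne (fun t => by
      rw [← truncationSet_eq_realIcc]
      exact mem_truncationSet_iff hG hv hpos t) f hf hfl _ hmem
    rw [studentized_eq hG hv]
    exact h2
  · linarith

/-- Asymptotic uniformity of p-values that are functions of the distribution function of the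
truncated normal law. -/
theorem asymptoticallyValidGiven_comp_pLower (hv : v ≠ 0)
    (hgood : ∀ᶠ T in atTop, 0 < T ∧ 0 < (R T).lam ∧
      IsUnit ((selDesign (R T) (M T))ᵀ * selDesign (R T) (M T)).det ∧
      selCoef (R T) (M T) j = 0 ∧ responseLaw (R T) v (selectionEvent (R T) (M T) S) ≠ 0)
    (hcons : ConsistentGiven (fun T => responseLaw (R T) v)
      (fun T => selectionEvent (R T) (M T) S) vhat (v : ℝ))
    {φ : ℝ → ℝ} (hφ : Measurable φ) (hφL : ∀ a b, |φ a - φ b| ≤ 2 * |a - b|)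
    (hu : ∀ (P : Measure ℝ) [IsProbabilityMeasure P] [NullSingletonClass P] (x : ℝ),
      0 ≤ x → x ≤ 1 → P.real {u | φ (P.real (Set.Iic u)) ≤ x} = x) :
    AsymptoticallyValidGiven (fun T => responseLaw (R T) v)
      (fun T => selectionEvent (R T) (M T) S)
      (fun T y => φ (pLower (R T) (M T) j (vhat T) y)) := by
  refine asymptoticallyValidGiven_of_uniform
    (q := fun T y => φ ((truncNormal (realIcc
      (lowerEnd (R T) (M T) j v (lassoSigns (R T) (M T) y) (resid (R T) (M T) j y))
      (upperEnd (R T) (M T) j v (lassoSigns (R T) (M T) y) (resid (R T) (M T) j y)))).real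
        (Set.Iic (standardized (R T) (M T) j v y)))) ?_ ?_ ?_
  · filter_upwards [hgood] with T ⟨_, _, _, _, hE⟩
    exact cond_isProbabilityMeasure hE
  · filter_upwards [hgood] with T ⟨hT, hlam, hG, hnull, hE⟩ x hx0 hx1
    exact (isTruncationModel hT hlam hG hv hnull S).measureReal_pvalue_le hE hφ
      fun P _ _ => hu P x hx0 hx1
  · intro δ hδ
    obtain ⟨ε, hε, hr⟩ := exists_pos_of_eventually_nhds_one hv
      (eventually_abs_cdf_sub_scaled_le (show (0 : ℝ) < δ / 2 by positivity))
    refine squeeze_zero' (Eventually.of_forall fun _ => measureReal_nonneg) ?_ (hcons ε hε)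
    filter_upwards [hgood] with T ⟨hT, hlam, hG, hnull, hE⟩
    have H := isTruncationModel hT hlam hG hv hnull S
    have := cond_isProbabilityMeasure hE
    refine ENNReal.toReal_mono (measure_ne_top _ _) (measure_mono_ae ?_)
    filter_upwards [H.ae_mem_and_ne_zero] with y ⟨hmem, hne⟩ hy
    by_contra hyN
    obtain ⟨hpos, h⟩ := hr (vhat T y) (not_le.1 hyN)
    have h2 := h _ _ _ _ hne (fun t => by
      rw [← truncationSet_eq_realIcc]
      exact mem_truncationSet_iff hG hv hpos t) (standardized (R T) (M T) j v y)
    rw [← truncationSet_eq_realIcc, ← studentized_eq hG hv] at h2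
    refine absurd hy (not_lt.2 ((hφL _ _).trans ?_))
    rw [pLower]
    linarith

end Limits

end

end

end WeightedLasso

theorem mainTheorem6
    (R : ∀ T : ℕ, WeightedLasso.Regression T)
    (v : ℝ≥0) (hv : v ≠ 0)
    -- the selected covariates, the selected signs, the coefficient to be tested
    {m : ℕ} (M : ∀ T : ℕ, Fin m ↪ Fin (R T).J) (S : Set (Fin m → SignType)) (j : Fin m)
    -- the estimator of the residual variance
    (vhat : ∀ T : ℕ, (Fin T → ℝ) → ℝ) (hvhat : ∀ T, Measurable (vhat T))
    -- penalty and weights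
    (hlam : ∀ᶠ T in atTop, 0 < (R T).lam)
    (hweight : ∀ᶠ T in atTop, WeightedLasso.AdmissibleWeights (R T))
    -- low dimensional truth, general position, sufficient observations
    (hsparse : (fun T : ℕ => (({i | (R T).coef i ≠ 0} : Set (Fin (R T).J)).ncard : ℝ))
      =O[atTop] (fun _ : ℕ => (1 : ℝ)))
    (hgp : ∀ᶠ T in atTop, WeightedLasso.GeneralPosition (R T))
    (hJT : ∀ᶠ T in atTop, (R T).J < T)
    -- the conditioning events have positive probability
    (hpos : ∀ᶠ T in atTop, WeightedLasso.responseLaw (R T) v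
      (WeightedLasso.selectionEvent (R T) (M T) S) ≠ 0)
    -- consistent variance estimator given the selection
    (hcons : WeightedLasso.ConsistentGiven (fun T => WeightedLasso.responseLaw (R T) v)
      (fun T => WeightedLasso.selectionEvent (R T) (M T) S) vhat (v : ℝ))
    -- full-rank limit of the second moment matrix of the selected covariates
    (hgram : ∃ G : Matrix (Fin m) (Fin m) ℝ, G.rank = m ∧
      Tendsto (fun T : ℕ => (1 / (T : ℝ)) • ((WeightedLasso.selDesign (R T) (M T))ᵀ *
        WeightedLasso.selDesign (R T) (M T))) atTop (𝓝 G))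
    -- growth rates
    (hJ : (fun T : ℕ => ((R T).J : ℝ)) =O[atTop] (fun T : ℕ => (T : ℝ)))
    (hrate : (fun T : ℕ => (R T).lam) =O[atTop]
      (fun T : ℕ => √(Real.log ((R T).J : ℝ) / (T : ℝ))))
    -- null hypothesis
    (hnull : ∀ᶠ T in atTop, WeightedLasso.selCoef (R T) (M T) j = 0) :
    WeightedLasso.ConvergesWeaklyGiven (fun T => WeightedLasso.responseLaw (R T) v)
      (fun T => WeightedLasso.selectionEvent (R T) (M T) S)
      (fun T => WeightedLasso.resid (R T) (M T) j)
      (fun T => WeightedLasso.studentized (R T) (M T) j (vhat T))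
      (fun T y => WeightedLasso.truncNormal
        (WeightedLasso.truncationSet (R T) (M T) j (vhat T) y)) ∧
    WeightedLasso.AsymptoticallyValidGiven (fun T => WeightedLasso.responseLaw (R T) v)
      (fun T => WeightedLasso.selectionEvent (R T) (M T) S)
      (fun T => WeightedLasso.pLower (R T) (M T) j (vhat T)) ∧
    WeightedLasso.AsymptoticallyValidGiven (fun T => WeightedLasso.responseLaw (R T) v)
      (fun T => WeightedLasso.selectionEvent (R T) (M T) S)
      (fun T => WeightedLasso.pUpper (R T) (M T) j (vhat T)) ∧
    WeightedLasso.AsymptoticallyValidGiven (fun T => WeightedLasso.responseLaw (R T) v)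
      (fun T => WeightedLasso.selectionEvent (R T) (M T) S)
      (fun T => WeightedLasso.pTwoSided (R T) (M T) j (vhat T)) := by
  have hgood : ∀ᶠ T in atTop, 0 < T ∧ 0 < (R T).lam ∧
      IsUnit ((WeightedLasso.selDesign (R T) (M T))ᵀ * WeightedLasso.selDesign (R T) (M T)).det ∧
      WeightedLasso.selCoef (R T) (M T) j = 0 ∧
      WeightedLasso.responseLaw (R T) v (WeightedLasso.selectionEvent (R T) (M T) S) ≠ 0 := by
    filter_upwards [eventually_gt_atTop 0, hlam, WeightedLasso.eventually_isUnit_det hgram, hnull,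
      hpos] with T h1 h2 h3 h4 h5
    exact ⟨h1, h2, h3, h4, h5⟩
  refine ⟨WeightedLasso.convergesWeaklyGiven_studentized hv hvhat hgood hcons, ?_, ?_, ?_⟩
  · refine WeightedLasso.asymptoticallyValidGiven_comp_pLower (φ := fun p => p) hv hgood hcons
      measurable_id (fun a b => ?_) fun P _ _ x h0 h1 => WeightedLasso.measureReal_cdf_le h0 h1
    linarith [abs_nonneg (a - b)]
  · refine WeightedLasso.asymptoticallyValidGiven_comp_pLower (φ := fun p => 1 - p) hv hgood hcons
      (by fun_prop) (fun a b => ?_) fun P _ _ x h0 h1 =>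
        WeightedLasso.measureReal_one_sub_cdf_le h0 h1
    rw [show 1 - a - (1 - b) = b - a by ring, abs_sub_comm b a]
    linarith [abs_nonneg (a - b)]
  · refine WeightedLasso.asymptoticallyValidGiven_comp_pLower
      (φ := fun p => 2 * min p (1 - p)) hv hgood hcons (by fun_prop) (fun a b => ?_)
      fun P _ _ x h0 h1 => WeightedLasso.measureReal_two_mul_min_cdf_le h0 h1
    rw [← mul_sub, abs_mul, abs_two]
    refine mul_le_mul_of_nonneg_left ((abs_min_sub_min_le_max _ _ _ _).trans ?_) zero_le_two
    rw [show 1 - a - (1 - b) = b - a by ring, abs_sub_comm b a, max_self]
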